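/- Let $M$ be a smooth four-dimensional manifold with a three-web $W(3,2,2)$, i.e. three smooth foliations $\lambda_1,\lambda_2,\lambda_3$ of codimension two whose tangent planes are pairwise transversal at every point. On an open set $U\subset M$ let $\omega_\xi^i$ ($\xi=1,2,3$; $i=1,2$) be an adapted coframe: smooth $1$-forms such that the leaves of $\lambda_\xi$ are given by $\omega_\xi^1=\omega_\xi^2=0$ and $\omega_1^i+\omega_2^i+\omega_3^i=0$. Then there are smooth $1$-forms $\omega_j^i$, smooth functions $a_1,a_2$ (the components of the torsion covector) and functions $p_{ij},q_{ij}$ (the Pfaffian derivatives of the $a_i$) on $U$ such that (summing over repeated indices $j=1,2$) $$d\omega_1^i=\omega_1^j\wedge\omega_j^i+a_j\,\omega_1^j\wedge\omega_1^i,\qquad d\omega_2^i=\omega_2^j\wedge\omega_j^i-a_j\,\omega_2^j\wedge\omega_2^i,\qquad da_i-a_j\omega_i^j=p_{ij}\omega_1^j+q_{ij}\omega_2^j .$$ For any such $\omega_j^i,a_i,p_{ij},q_{ij}$ with $(a_1,a_2)\neq(0,0)$ at every point of $U$, the transversal $a$-distribution $\Delta$ on $U$, defined by $$a_1\omega_1^1+a_2\omega_1^2=0,\qquad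 a_1\omega_2^1+a_2\omega_2^2=0,$$ is integrable (i.e. a smooth two-dimensional integral surface of $\Delta$ passes through every point of $U$) if and only if everywhere on $U$ $$a_2^2\,p_{11}-2a_1a_2\,p_{(12)}+a_1^2\,p_{22}=0\quad\text{and}\quad a_2^2\,q_{11}-2a_1a_2\,q_{(12)}+a_1^2\,q_{22}=0,$$ where $p_{(12)}=\tfrac12(p_{12}+p_{21})$ and $q_{(12)}=\tfrac12(q_{12}+q_{21})$. -/

import Mathlib

open scoped Manifold ContDiff

noncomputable section

namespace ThreeWebs

variable (M : Type*) [TopologicalSpace M] [ChartedSpace (EuclideanSpace ℝ (Fin 4)) M]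

/-- A (not necessarily continuous) field of tangent subspaces on the four-manifold `M`. -/
abbrev SubspaceField := ∀ x : M, Submodule ℝ (TangentSpace (𝓡 4) x)

/-- A (not necessarily smooth) differential `1`-form on the four-manifold `M`. -/
abbrev OneForm := ∀ x : M, TangentSpace (𝓡 4) x →L[ℝ] ℝ

variable {M}

/-! Exterior calculus of `1`-forms on `M`. -/

/-- The expression of a `1`-form in the preferred chart at `x₀`: its pullback under the inverse of
the chart, a `1`-form on the model space (meaningful on the target of the chart). -/
def chartRep (α : OneForm M) (x₀ : M) (y : EuclideanSpace ℝ (Fin 4)) :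
    EuclideanSpace ℝ (Fin 4) →L[ℝ] ℝ :=
  ((α ((extChartAt (𝓡 4) x₀).symm y)).comp
    (mfderiv (𝓡 4) (𝓡 4) (extChartAt (𝓡 4) x₀).symm y) : TangentSpace (𝓡 4) y →L[ℝ] ℝ)

/-- Smoothness of a `1`-form on an open set: its chart expressions are smooth. -/
def SmoothFormOn (α : OneForm M) (U : Set M) : Prop :=
  ∀ x ∈ U, ContDiffAt ℝ ∞ (chartRep α x) (extChartAt (𝓡 4) x x)

/-- The exterior derivative of a `1`-form at `x`, evaluated on two tangent vectors: the exterior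
derivative of the expression of the form in the chart at `x`, so that
`dα(X, Y) = X(α(Y)) - Y(α(X)) - α([X, Y])`. -/
def extD (α : OneForm M) (x : M) (v w : TangentSpace (𝓡 4) x) : ℝ :=
  extDeriv
    (fun y => ContinuousAlternatingMap.ofSubsingleton ℝ (EuclideanSpace ℝ (Fin 4)) ℝ (0 : Fin 1)
      (chartRep α x y))
    (extChartAt (𝓡 4) x x)
    ![mfderiv (𝓡 4) (𝓡 4) (extChartAt (𝓡 4) x) x v,
      mfderiv (𝓡 4) (𝓡 4) (extChartAt (𝓡 4) x) x w]

/-- The differential of a real function, as a `1`-form. -/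
def differential (f : M → ℝ) : OneForm M :=
  fun x => mfderiv (𝓡 4) 𝓘(ℝ) f x

/-- The wedge product of two `1`-forms at `x`, evaluated on two tangent vectors. -/
def wedge (α β : OneForm M) (x : M) (v w : TangentSpace (𝓡 4) x) : ℝ :=
  α x v * β x w - α x w * β x v

/-! Three-webs `W(3, 2, 2)`. -/

/-- The field `T` of tangent planes is the field of tangent planes of the leaves of a smooth
foliation of codimension two: locally the leaves are the level sets of a submersion to `ℝ²`. -/
def IsFoliation (T : SubspaceField M) : Prop :=
  ∀ x : M, ∃ (U : Set M) (u : M → EuclideanSpace ℝ (Fin 2)), IsOpen U ∧ x ∈ U ∧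
    ContMDiffOn (𝓡 4) (𝓡 2) ∞ u U ∧
    ∀ y ∈ U, Function.Surjective (mfderiv (𝓡 4) (𝓡 2) u y) ∧
      T y = (mfderiv (𝓡 4) (𝓡 2) u y).ker

variable (M) in
/-- A three-web `W(3, 2, 2)` on a four-manifold: three foliations of codimension two in general
position, i.e. the tangent planes of any two of them are transversal at every point. -/
structure ThreeWeb where
  /-- the tangent plane at a point of the leaf of the foliation number `ξ` -/
  leafTangent : Fin 3 → SubspaceField M
  isFoliation : ∀ ξ, IsFoliation (leafTangent ξ)
  generalPosition : ∀ ξ η, ξ ≠ η → ∀ x, IsCompl (leafTangent ξ x) (leafTangent η x)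

/-- Adapted coframe of a web on `U`: smooth forms `θ ξ i` such that the leaves of the foliation
number `ξ` are given by `θ ξ 0 = θ ξ 1 = 0`, normalized by `θ 0 i + θ 1 i + θ 2 i = 0`. -/
structure ThreeWeb.IsAdaptedCoframe (W : ThreeWeb M) (U : Set M)
    (θ : Fin 3 → Fin 2 → OneForm M) : Prop where
  smooth : ∀ ξ i, SmoothFormOn (θ ξ i) U
  leaf_iff : ∀ ξ, ∀ x ∈ U, ∀ v : TangentSpace (𝓡 4) x,
    v ∈ W.leafTangent ξ x ↔ ∀ i, θ ξ i x v = 0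
  sum_eq_zero : ∀ i, ∀ x ∈ U, ∀ v : TangentSpace (𝓡 4) x, ∑ ξ, θ ξ i x v = 0

/-- The structure equations of a web on `U` with respect to an adapted coframe `θ`. Here `Γ j i` is
the connection form with lower index `j` and upper index `i`, and `a` is the torsion covector;
`p i j` and `q i j` are the Pfaffian derivatives of `a i` along `θ 0 j` and `θ 1 j`. -/
structure StructureEquations (U : Set M) (θ : Fin 3 → Fin 2 → OneForm M)
    (Γ : Fin 2 → Fin 2 → OneForm M) (a : Fin 2 → M → ℝ) (p q : Fin 2 → Fin 2 → M → ℝ) :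
    Prop where
  smooth_connection : ∀ j i, SmoothFormOn (Γ j i) U
  smooth_covector : ∀ i, ContMDiffOn (𝓡 4) 𝓘(ℝ) ∞ (a i) U
  first : ∀ i, ∀ x ∈ U, ∀ v w : TangentSpace (𝓡 4) x,
    extD (θ 0 i) x v w =
      ∑ j, wedge (θ 0 j) (Γ j i) x v w + ∑ j, a j x * wedge (θ 0 j) (θ 0 i) x v w
  second : ∀ i, ∀ x ∈ U, ∀ v w : TangentSpace (𝓡 4) x,
    extD (θ 1 i) x v w =
      ∑ j, wedge (θ 1 j) (Γ j i) x v w - ∑ j, a j x * wedge (θ 1 j) (θ 1 i) x v w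
  pfaffian : ∀ i, ∀ x ∈ U, ∀ v : TangentSpace (𝓡 4) x,
    differential (a i) x v - ∑ j, a j x * Γ i j x v =
      ∑ j, (p i j x * θ 0 j x v + q i j x * θ 1 j x v)

/-- The transversal `a`-distribution: `a₁ θ₁¹ + a₂ θ₁² = 0`, `a₁ θ₂¹ + a₂ θ₂² = 0`. -/
def transversalDistribution (θ : Fin 3 → Fin 2 → OneForm M) (a : Fin 2 → M → ℝ) :
    SubspaceField M :=
  fun x => (∑ i, a i x • θ 0 i x).ker ⊓ (∑ i, a i x • θ 1 i x).ker

/-- A field of tangent planes is integrable on `U` if through every point of `U` there passes a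
smooth two-dimensional integral surface, i.e. an immersed surface in `U` whose tangent plane at
each of its points is the given one. -/
def IsIntegrableOn (D : SubspaceField M) (U : Set M) : Prop :=
  ∀ x ∈ U, ∃ (V : Set (EuclideanSpace ℝ (Fin 2))) (φ : EuclideanSpace ℝ (Fin 2) → M),
    IsOpen V ∧ 0 ∈ V ∧ φ 0 = x ∧ Set.MapsTo φ V U ∧ ContMDiffOn (𝓡 2) (𝓡 4) ∞ φ V ∧
    ∀ t ∈ V, Function.Injective (mfderiv (𝓡 2) (𝓡 4) φ t) ∧
      (mfderiv (𝓡 2) (𝓡 4) φ t).range = D (φ t)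

end ThreeWebs

end

/-! Existence. Take the frame dual to the coframe `θ 0 i`, `θ 1 i`. The values of `dθ 0 i` and `dθ 1
i` on mixed pairs (one vector from each half of the frame) leave exactly one choice for the
connection forms. Integrability of the first two foliations removes the pure terms that the
equations do not allow. What remains of `dθ 0 i` is a skew form in two variables for each of the two
values of `i`, hence always of the shape `a j θ 0 j ∧ θ 0 i`. Integrability of the third foliation
says that the same covector, with the opposite sign, serves `dθ 1 i`. The Pfaffian derivatives are
the frame components of the covariant differential of `a`.

Integrability. The plane field is the common kernel of the two forms `a i θ ξ i`, `ξ = 0, 1`.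
Substituting the structure equations, the connection terms combine with `da i` into the covariant
differential, and the torsion term cancels because `a i a j` is symmetric: `d(a i θ ξ i) = (da i - a
j Γ i j) ∧ θ ξ i`. The kernel is spanned by two vectors with the same components `(-a 1, a 0)` in
the two halves of the frame. On this pair the two exterior derivatives are, up to sign, the
quadratic forms of `q` and of `p` at `(-a 1, a 0)`; only the symmetric parts of `p` and `q` enter.
So the two identities say exactly that the derivatives vanish on the plane field.

That condition is necessary since `d` commutes with pullback to an integral surface
(`modelD_eq_zero_of_surface`). It is sufficient by the Frobenius theorem
(`isIntegrableOn_of_modelD_eq_zero`), which is reduced in a chart to a total differential equation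
`φ' = A ∘ φ` (`exists_integral_immersion`) and solved along rays from the origin
(`exists_total_solution`). -/

namespace ThreeWebs

section

open Set Filter Topology Metric

/-! ### Total differential equations -/

section Ode

variable {E P : Type*} [NormedAddCommGroup E] [NormedSpace ℝ E]
  [NormedAddCommGroup P] [NormedSpace ℝ P]

/-- An autonomous Lipschitz field bounded by `a` on the closed ball of radius `a` has an integral
curve on `[0, 1]` that starts at the centre and stays in the ball. -/
theorem exists_integralCurve_mem_closedBall [CompleteSpace E] {f : E → E} {x₀ : E} {a L : NNReal}
    (hL : LipschitzOnWith L f (closedBall x₀ a)) (hb : ∀ x ∈ closedBall x₀ (a : ℝ), ‖f x‖ ≤ a) :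
    ∃ α : ℝ → E, α 0 = x₀ ∧ (∀ t ∈ Icc (0 : ℝ) 1, α t ∈ closedBall x₀ (a : ℝ)) ∧
      ∀ t ∈ Icc (0 : ℝ) 1, HasDerivWithinAt α (f (α t)) (Icc 0 1) t := by
  have hf : IsPicardLindelof (fun _ ↦ f) (tmin := 0) (tmax := 1) ⟨0, by simp⟩ x₀ a 0 a L :=
    .of_time_independent hb hL (by simp)
  obtain ⟨α, hα⟩ := ODE.FunSpace.exists_isFixedPt_next hf (mem_closedBall_self le_rfl)
  refine ⟨α.compProj, ?_, fun t _ ↦ α.compProj_mem_closedBall hf.mul_max_le, fun t ht ↦ ?_⟩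
  · have := ODE.FunSpace.compProj_val (α := α) (t := ⟨0, by simp⟩)
    rw [this, ← hα, ODE.FunSpace.next_apply₀]
  apply ODE.hasDerivWithinAt_picard_Icc (t₀ := (0 : ℝ)) (by simp) hf.continuousOn_uncurry
    α.continuous_compProj.continuousOn (fun _ ht' ↦ α.compProj_mem_closedBall hf.mul_max_le)
    x₀ ht |>.congr_of_mem _ ht
  intro t' ht'
  nth_rw 1 [← hα]
  rw [ODE.FunSpace.compProj_of_mem ht', ODE.FunSpace.next_apply]

/-- Second order Taylor estimate from a Lipschitz bound on the derivative. -/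
theorem norm_sub_sub_fderiv_le {G : Type*} [NormedAddCommGroup G] [NormedSpace ℝ G]
    {A : E → G} {s : Set E} (hs : Convex ℝ s) (hd : ∀ x ∈ s, DifferentiableAt ℝ A x) {M : ℝ}
    (hM0 : 0 ≤ M) (hM : ∀ x ∈ s, ∀ y ∈ s, ‖fderiv ℝ A x - fderiv ℝ A y‖ ≤ M * ‖x - y‖)
    {z w : E} (hz : z ∈ s) (hw : w ∈ s) :
    ‖A w - A z - fderiv ℝ A z (w - z)‖ ≤ M * ‖w - z‖ * ‖w - z‖ := by
  have hsub : segment ℝ z w ⊆ s := hs.segment_subset hz hw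
  -- The mean value inequality is applied on the segment only, where the derivative differs from its
  -- value at `z` by at most `M * ‖w - z‖`.
  refine (convex_segment z w).norm_image_sub_le_of_norm_hasFDerivWithin_le'
    (f' := fderiv ℝ A) (fun x hx ↦ (hd x (hsub hx)).hasFDerivAt.hasFDerivWithinAt)
    (fun x hx ↦ (hM x (hsub hx) z hz).trans ?_) (left_mem_segment ℝ z w) (right_mem_segment ℝ z w)
  gcongr
  obtain ⟨t, ht, rfl⟩ := (segment_eq_image' ℝ z w) ▸ hx
  simp only [add_sub_cancel_left, norm_smul, Real.norm_eq_abs, abs_of_nonneg ht.1]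
  exact mul_le_of_le_one_left (norm_nonneg _) ht.2

/-- Bounds on a closed ball for a twice continuously differentiable map. -/
theorem exists_closedBall_bounds {G : Type*} [NormedAddCommGroup G] [NormedSpace ℝ G]
    {A : E → G} {x₀ : E} (hA : ContDiffAt ℝ 2 A x₀) {s : Set E} (hs : s ∈ 𝓝 x₀) :
    ∃ a > 0, closedBall x₀ a ⊆ s ∧ ∃ K : ℝ, 0 < K ∧
      (∀ x ∈ closedBall x₀ a, DifferentiableAt ℝ A x) ∧
      (∀ x ∈ closedBall x₀ a, ‖A x‖ ≤ K) ∧ (∀ x ∈ closedBall x₀ a, ‖fderiv ℝ A x‖ ≤ K) ∧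
      ∀ x ∈ closedBall x₀ a, ∀ y ∈ closedBall x₀ a,
        ‖fderiv ℝ A x - fderiv ℝ A y‖ ≤ K * ‖x - y‖ := by
  have hA' : ContDiffAt ℝ 1 (fderiv ℝ A) x₀ := hA.fderiv_right (by norm_num)
  obtain ⟨M, t, ht, hM⟩ := hA'.exists_lipschitzOnWith
  have h1 : ∀ᶠ x in 𝓝 x₀, DifferentiableAt ℝ A x :=
    (hA.eventually (by simp)).mono fun x hx ↦ hx.differentiableAt (by simp)
  have h2 : ∀ᶠ x in 𝓝 x₀, ‖A x‖ < ‖A x₀‖ + 1 :=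
    hA.continuousAt.norm.eventually_lt continuousAt_const (by simp)
  have h3 : ∀ᶠ x in 𝓝 x₀, ‖fderiv ℝ A x‖ < ‖fderiv ℝ A x₀‖ + 1 :=
    hA'.continuousAt.norm.eventually_lt continuousAt_const (by simp)
  obtain ⟨a, ha, hsub⟩ := nhds_basis_closedBall.mem_iff.1
    (inter_mem hs (inter_mem ht (h1.and (h2.and h3))))
  refine ⟨a, ha, fun x hx ↦ (hsub hx).1, ‖A x₀‖ + ‖fderiv ℝ A x₀‖ + M + 1, by positivity,
    fun x hx ↦ (hsub hx).2.2.1, fun x hx ↦ ?_, fun x hx ↦ ?_, fun x hx y hy ↦ ?_⟩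
  · have := (hsub hx).2.2.2.1
    have := norm_nonneg (fderiv ℝ A x₀)
    have := M.2
    simp only [NNReal.val_eq_coe] at this
    linarith
  · have := (hsub hx).2.2.2.2
    have := norm_nonneg (A x₀)
    have := M.2
    simp only [NNReal.val_eq_coe] at this
    linarith
  · have := hM.norm_sub_le (hsub hx).2.1 (hsub hy).2.1
    refine this.trans ?_
    gcongr
    have := norm_nonneg (fderiv ℝ A x₀)
    have := norm_nonneg (A x₀)
    linarith

/-- With equal initial values the Grönwall bound is linear in the defect, so a defect quadratic in
`h` yields an error quadratic in `h`. -/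
theorem gronwallBound_zero_eq_mul (K ε x : ℝ) (hK : K ≠ 0) :
    gronwallBound 0 K ε x = gronwallBound 0 K 1 x * ε := by
  simp only [gronwallBound_of_K_ne_0 hK]
  ring

/-- A total differential equation `φ'(p) = A (φ p)` whose integrability condition holds near `x₀`
has a local solution with `φ 0 = x₀`. -/
theorem exists_total_solution [CompleteSpace E] {A : E → P →L[ℝ] E} {x₀ : E}
    (hA : ContDiffAt ℝ 2 A x₀) {s : Set E} (hs : s ∈ 𝓝 x₀)
    (hsymm : ∀ x ∈ s, ∀ h k : P, fderiv ℝ A x (A x h) k = fderiv ℝ A x (A x k) h) :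
    ∃ (φ : P → E) (r : ℝ), 0 < r ∧ φ 0 = x₀ ∧
      ∀ p ∈ ball (0 : P) r, φ p ∈ s ∧ HasFDerivAt φ (A (φ p)) p := by
  obtain ⟨a, ha, hsub, K, hK, hd, hAK, hDK, hLip⟩ := exists_closedBall_bounds hA hs
  have hhalf : closedBall x₀ (a / 2) ⊆ closedBall x₀ a := closedBall_subset_closedBall (by linarith)
  have hALip : ∀ x ∈ closedBall x₀ a, ∀ y ∈ closedBall x₀ a, ‖A x - A y‖ ≤ K * ‖x - y‖ :=
    fun x hx y hy ↦ (convex_closedBall x₀ a).norm_image_sub_le_of_norm_fderiv_le hd hDK hy hx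
  -- For `‖p‖ < r` the field `x ↦ A x p` has speed at most `K * r = a / 2`, so its curves stay in
  -- the half ball up to time `1`. The other half leaves room for the comparison curve `w` below.
  set r : ℝ := a / 2 / K with hr
  have hr0 : 0 < r := by positivity
  have hKr : K * r = a / 2 := by rw [hr]; field_simp
  have hfLip : ∀ p ∈ ball (0 : P) r,
      LipschitzOnWith (K * r).toNNReal (fun x ↦ A x p) (closedBall x₀ a) := by
    intro p hp
    refine LipschitzOnWith.of_dist_le_mul fun x hx y hy ↦ ?_
    rw [dist_eq_norm, dist_eq_norm, Real.coe_toNNReal _ (by positivity),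
      ← sub_apply]
    refine ((A x - A y).le_opNorm p).trans ?_
    calc ‖A x - A y‖ * ‖p‖ ≤ (K * ‖x - y‖) * r := by
          gcongr
          · exact hALip x hx y hy
          · exact (mem_ball_zero_iff.1 hp).le
      _ = K * r * ‖x - y‖ := by ring
  have hex : ∀ p : P, ∃ z : ℝ → E, p ∈ ball (0 : P) r → z 0 = x₀ ∧
      (∀ t ∈ Icc (0 : ℝ) 1, z t ∈ closedBall x₀ (a / 2)) ∧
      ∀ t ∈ Icc (0 : ℝ) 1, HasDerivWithinAt z (A (z t) p) (Icc 0 1) t := by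
    intro p
    by_cases hp : p ∈ ball (0 : P) r
    · obtain ⟨z, h⟩ := exists_integralCurve_mem_closedBall (f := fun x ↦ A x p) (x₀ := x₀)
        (a := (a / 2).toNNReal) (L := (K * r).toNNReal)
        ((hfLip p hp).mono (by rwa [Real.coe_toNNReal _ (by positivity)]))
        (fun x hx ↦ by
          rw [Real.coe_toNNReal _ (by positivity)] at hx ⊢
          refine ((A x).le_opNorm p).trans ?_
          rw [← hKr]
          gcongr
          · exact hAK x (hhalf hx)
          · exact (mem_ball_zero_iff.1 hp).le)
      rw [Real.coe_toNNReal _ (by positivity)] at h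
      exact ⟨z, fun _ ↦ h⟩
    · exact ⟨0, fun h ↦ (hp h).elim⟩
  choose z hz using hex
  -- Along the ray `t ↦ t • p` a solution must be an integral curve of `x ↦ A x p`; hence the value
  -- at `p` is that of the curve at time `1`.
  refine ⟨fun p ↦ z p 1, r, hr0, ?_, fun p hp ↦ ⟨hsub (hhalf ((hz p hp).2.1 1 (by simp))), ?_⟩⟩
  · obtain ⟨h0, -, hd0⟩ := hz 0 (mem_ball_self hr0)
    have := constant_of_derivWithin_zero (f := z 0) (a := 0) (b := 1)
      (fun t ht ↦ (hd0 t ht).differentiableWithinAt)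
      (fun t ht ↦ by
        rw [(hd0 t (Ico_subset_Icc_self ht)).derivWithin
          (uniqueDiffOn_Icc zero_lt_one t (Ico_subset_Icc_self ht))]
        simp)
    exact (this 1 (by simp)).trans h0
  set D : ℝ := gronwallBound 0 (K * r) 1 1 * (K * K + K * (K * K) * r) with hD
  have key : ∀ᶠ h in 𝓝 (0 : P), ‖z (p + h) 1 - z p 1 - A (z p 1) h‖ ≤ D * ‖h‖ ^ 2 := by
    have hmem1 : ∀ᶠ h in 𝓝 (0 : P), p + h ∈ ball (0 : P) r := by
      refine (continuous_const.add continuous_id).continuousAt.eventually_mem ?_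
      simpa using isOpen_ball.mem_nhds hp
    filter_upwards [hmem1, ball_mem_nhds (0 : P) hr0] with h hph hh
    obtain ⟨h0, hm, hder⟩ := hz p hp
    obtain ⟨h0', hm', hder'⟩ := hz (p + h) hph
    have hder1 : ∀ t ∈ Ico (0 : ℝ) 1, HasDerivWithinAt (z p) (A (z p t) p) (Ici t) t :=
      fun t ht ↦ (hder t (Ico_subset_Icc_self ht)).mono_of_mem_nhdsWithin
        (Icc_mem_nhdsGE_of_mem ht)
    -- The expected first order approximation of `z (p + h)`. It starts at the same point, and at
    -- time `1` it is the claimed linearization.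
    set w : ℝ → E := fun t ↦ z p t + t • A (z p t) h with hw
    set w' : ℝ → E := fun t ↦ A (z p t) p + (A (z p t) h +
      t • fderiv ℝ A (z p t) (A (z p t) p) h) with hw'
    have hwd : ∀ (t : ℝ) (u : Set ℝ), t ∈ Icc (0 : ℝ) 1 →
        HasDerivWithinAt (z p) (A (z p t) p) u t → HasDerivWithinAt w (w' t) u t := by
      intro t u ht hzt
      have h1 : HasDerivWithinAt (fun t ↦ A (z p t)) (fderiv ℝ A (z p t) (A (z p t) p)) u t :=
        (hd _ (hhalf (hm t ht))).hasFDerivAt.comp_hasDerivWithinAt t hzt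
      have h2 := (hasDerivWithinAt_id t u).smul (h1.clm_apply (hasDerivWithinAt_const t u h))
      convert! hzt.add h2 using 1
      simp [hw']
      abel
    have hwmem : ∀ t ∈ Icc (0 : ℝ) 1, w t ∈ closedBall x₀ a ∧ ‖w t - z p t‖ ≤ K * ‖h‖ := by
      intro t ht
      have hAh : ‖t • A (z p t) h‖ ≤ K * ‖h‖ := by
        rw [norm_smul, Real.norm_eq_abs, abs_of_nonneg ht.1]
        refine (mul_le_of_le_one_left (norm_nonneg _) ht.2).trans (((A _).le_opNorm h).trans ?_)
        gcongr
        exact hAK _ (hhalf (hm t ht))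
      refine ⟨?_, by simpa [hw] using hAh⟩
      have h3 := hm t ht
      rw [mem_closedBall_iff_norm] at h3 ⊢
      have h4 : w t - x₀ = (z p t - x₀) + t • A (z p t) h := by simp [hw]; abel
      have h5 : K * ‖h‖ ≤ a / 2 := by
        rw [← hKr]; gcongr; exact (mem_ball_zero_iff.1 hh).le
      rw [h4]
      linarith [norm_add_le (z p t - x₀) (t • A (z p t) h)]
    have hbound : ∀ t ∈ Ico (0 : ℝ) 1, dist (w' t) (A (w t) (p + h)) ≤
        (K * K + K * (K * K) * r) * ‖h‖ ^ 2 := by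
      intro t ht
      have ht' := Ico_subset_Icc_self ht
      have hzs := hhalf (hm t ht')
      obtain ⟨hws, hwz⟩ := hwmem t ht'
      have hT := norm_sub_sub_fderiv_le (convex_closedBall x₀ a) hd hK.le hLip hzs hws
      have hwsub : w t - z p t = t • A (z p t) h := by simp [hw]
      -- The integrability condition swaps `p` and `h` in the second term of `w'`, which cancels all
      -- terms of first order in `h`.
      have hid : w' t - A (w t) (p + h) = -(t • fderiv ℝ A (z p t) (A (z p t) h) h) -
          (A (w t) - A (z p t) - fderiv ℝ A (z p t) (w t - z p t)) (p + h) := by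
        have := hsymm _ (hsub hzs) p h
        simp only [hwsub, hw', sub_apply, map_smul, map_add,
          smul_apply, this]
        abel
      rw [dist_eq_norm, hid]
      refine (norm_sub_le _ _).trans ?_
      have e1 : ‖-(t • fderiv ℝ A (z p t) (A (z p t) h) h)‖ ≤ K * K * ‖h‖ ^ 2 := by
        rw [norm_neg, norm_smul, Real.norm_eq_abs, abs_of_nonneg ht.1]
        refine (mul_le_of_le_one_left (norm_nonneg _) ht.2.le).trans ?_
        refine (ContinuousLinearMap.le_opNorm₂ _ _ _).trans ?_
        calc _ ≤ K * (K * ‖h‖) * ‖h‖ := by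
              gcongr
              · exact hDK _ hzs
              · refine ((A _).le_opNorm h).trans ?_
                gcongr
                exact hAK _ hzs
          _ = _ := by ring
      have e2 : ‖(A (w t) - A (z p t) - fderiv ℝ A (z p t) (w t - z p t)) (p + h)‖ ≤
          K * (K * K) * r * ‖h‖ ^ 2 := by
        refine (ContinuousLinearMap.le_opNorm _ _).trans ?_
        calc _ ≤ (K * (K * ‖h‖) * (K * ‖h‖)) * r := by
              gcongr
              · exact hT.trans (by gcongr)
              · exact (mem_ball_zero_iff.1 hph).le
          _ = _ := by ring
      linarith
    have hmain := dist_le_of_approx_trajectories_ODE_of_mem (K := (K * r).toNNReal)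
      (v := fun _ x ↦ A x (p + h)) (s := fun _ ↦ closedBall x₀ a) (a := 0) (b := 1)
      (f := z (p + h)) (g := w) (δ := 0) (εf := 0)
      (εg := (K * K + K * (K * K) * r) * ‖h‖ ^ 2)
      (f' := fun t ↦ A (z (p + h) t) (p + h)) (g' := w')
      (fun t _ ↦ hfLip _ hph)
      (fun t ht ↦ (hder' t ht).continuousWithinAt)
      (fun t ht ↦ (hder' t (Ico_subset_Icc_self ht)).mono_of_mem_nhdsWithin
        (Icc_mem_nhdsGE_of_mem ht))
      (fun t _ ↦ by simp)
      (fun t ht ↦ hhalf (hm' t (Ico_subset_Icc_self ht)))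
      (fun t ht ↦ (hwd t _ ht (hder t ht)).continuousWithinAt)
      (fun t ht ↦ hwd t _ (Ico_subset_Icc_self ht) (hder1 t ht))
      hbound
      (fun t ht ↦ (hwmem t (Ico_subset_Icc_self ht)).1)
      (by simp [hw, h0, h0']) 1 (by simp)
    rw [Real.coe_toNNReal _ (by positivity), gronwallBound_zero_eq_mul _ _ _ (by positivity),
      dist_eq_norm] at hmain
    simp only [hw, one_smul, sub_zero, zero_add] at hmain
    rw [sub_sub, hD]
    linarith
  rw [hasFDerivAt_iff_isLittleO_nhds_zero]
  refine (Asymptotics.IsBigO.of_bound D (g := fun h : P ↦ ‖h‖ ^ 2) ?_).trans_isLittleO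
    (Asymptotics.isLittleO_norm_pow_id one_lt_two)
  filter_upwards [key] with h hh
  simpa using hh

/-- Solutions of `φ' = A ∘ φ` are as smooth as `A`. -/
theorem contDiffOn_of_hasFDerivAt_comp {A : E → P →L[ℝ] E} {s : Set E} (hA : ContDiffOn ℝ ∞ A s)
    {φ : P → E} {u : Set P} (hu : IsOpen u)
    (h : ∀ p ∈ u, φ p ∈ s ∧ HasFDerivAt φ (A (φ p)) p) : ContDiffOn ℝ ∞ φ u := by
  rw [contDiffOn_infty]
  intro n
  -- Bootstrapping: if `φ` is of class `C^n`, so is `φ' = A ∘ φ`, hence `φ` is of class `C^(n+1)`.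
  induction n with
  | zero =>
    simp only [Nat.cast_zero, contDiffOn_zero]
    exact fun p hp ↦ (h p hp).2.continuousAt.continuousWithinAt
  | succ n ih =>
    rw [Nat.cast_succ, contDiffOn_succ_iff_fderiv_of_isOpen hu]
    refine ⟨fun p hp ↦ (h p hp).2.differentiableAt.differentiableWithinAt, by simp, ?_⟩
    refine ((hA.of_le (mod_cast le_top)).comp ih fun p hp ↦ (h p hp).1).congr fun p hp ↦ ?_
    exact (h p hp).2.fderiv

end Ode

/-! ### Exterior derivative of vector valued forms on a normed space -/

section FlatForms

variable {E F G P : Type*} [NormedAddCommGroup E] [NormedSpace ℝ E]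
  [NormedAddCommGroup F] [NormedSpace ℝ F] [NormedAddCommGroup G] [NormedSpace ℝ G]
  [NormedAddCommGroup P] [NormedSpace ℝ P]

/-- The exterior derivative of a vector valued `1`-form on a normed space, on two vectors. -/
noncomputable def flatD (η : E → E →L[ℝ] F) (y v w : E) : F :=
  fderiv ℝ η y v w - fderiv ℝ η y w v

theorem flatD_congr {η η' : E → E →L[ℝ] F} {y : E} (h : η =ᶠ[𝓝 y] η') (v w : E) :
    flatD η y v w = flatD η' y v w := by
  simp only [flatD, h.fderiv_eq]

theorem flatD_clm_comp {C : E → F →L[ℝ] G} {η : E → E →L[ℝ] F} {y : E}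
    (hC : DifferentiableAt ℝ C y) (hη : DifferentiableAt ℝ η y) (v w : E) :
    flatD (fun z ↦ (C z).comp (η z)) y v w =
      fderiv ℝ C y v (η y w) - fderiv ℝ C y w (η y v) + C y (flatD η y v w) := by
  simp only [flatD, fderiv_clm_comp hC hη]
  simp
  abel

theorem flatD_fderiv {ψ : E → F} {y : E} (hψ : ContDiffAt ℝ 2 ψ y) (v w : E) :
    flatD (fderiv ℝ ψ) y v w = 0 := by
  have := hψ.isSymmSndFDerivAt (by simp)
  simp [flatD, this.eq v w]

/-- The terms with the second derivative of `ψ` cancel by its symmetry. -/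
theorem flatD_pullback {η : E → E →L[ℝ] F} {ψ : P → E} {p : P}
    (hη : DifferentiableAt ℝ η (ψ p)) (hψ : ContDiffAt ℝ 2 ψ p) (v w : P) :
    flatD (fun q ↦ (η (ψ q)).comp (fderiv ℝ ψ q)) p v w =
      flatD η (ψ p) (fderiv ℝ ψ p v) (fderiv ℝ ψ p w) := by
  have hd : DifferentiableAt ℝ ψ p := hψ.differentiableAt (by simp)
  have hd2 : DifferentiableAt ℝ (fderiv ℝ ψ) p :=
    (hψ.fderiv_right (m := 1) (by norm_num)).differentiableAt (by simp)
  have hs := hψ.isSymmSndFDerivAt (by simp)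
  have hc : DifferentiableAt ℝ (fun q ↦ η (ψ q)) p := hη.comp p hd
  have hc' : fderiv ℝ (fun q ↦ η (ψ q)) p = (fderiv ℝ η (ψ p)).comp (fderiv ℝ ψ p) :=
    fderiv_comp p hη hd
  simp only [flatD, fderiv_clm_comp hc hd2, hc']
  simp [hs.eq v w]

theorem flatD_smul {f : E → ℝ} {η : E → E →L[ℝ] F} {y : E} (hf : DifferentiableAt ℝ f y)
    (hη : DifferentiableAt ℝ η y) (v w : E) :
    flatD (fun z ↦ f z • η z) y v w =
      fderiv ℝ f y v • η y w - fderiv ℝ f y w • η y v + f y • flatD η y v w := by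
  simp only [flatD, fderiv_fun_smul hf hη]
  simp [smul_sub]
  abel

theorem flatD_sum {ι : Type*} {s : Finset ι} {η : ι → E → E →L[ℝ] F} {y : E}
    (hη : ∀ i ∈ s, DifferentiableAt ℝ (η i) y) (v w : E) :
    flatD (fun z ↦ ∑ i ∈ s, η i z) y v w = ∑ i ∈ s, flatD (η i) y v w := by
  simp only [flatD, fderiv_fun_sum hη]
  simp

/-- Written as a sum of compositions with constant maps, a family of forms is covered by the sum and
product rules. -/
theorem pi_eq_sum_single_comp {ι : Type*} [Fintype ι] [DecidableEq ι] (f : ι → E →L[ℝ] F) :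
    ContinuousLinearMap.pi f = ∑ i, (ContinuousLinearMap.single ℝ (fun _ : ι ↦ F) i).comp (f i) := by
  ext v j
  simp [Finset.sum_apply, Pi.single_apply]

theorem contDiffAt_pi_form {ι : Type*} [Fintype ι] {η : ι → E → E →L[ℝ] F} {y : E} {n : ℕ∞ω}
    (hη : ∀ i, ContDiffAt ℝ n (η i) y) :
    ContDiffAt ℝ n (fun z ↦ ContinuousLinearMap.pi fun i ↦ η i z) y := by
  classical
  simp only [pi_eq_sum_single_comp]
  exact ContDiffAt.sum fun i _ ↦ contDiffAt_const.clm_comp (hη i)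

theorem flatD_pi {ι : Type*} [Fintype ι] {η : ι → E → E →L[ℝ] F} {y : E}
    (hη : ∀ i, DifferentiableAt ℝ (η i) y) (v w : E) :
    flatD (fun z ↦ ContinuousLinearMap.pi fun i ↦ η i z) y v w = fun i ↦ flatD (η i) y v w := by
  classical
  simp only [pi_eq_sum_single_comp]
  rw [flatD_sum fun i _ ↦ (differentiableAt_const _).clm_comp (hη i)]
  simp only [flatD_clm_comp (differentiableAt_const _) (hη _)]
  ext j
  simp [Finset.sum_apply, Pi.single_apply]

end FlatForms

/-! ### Kernels of forms and the Frobenius theorem on a normed space -/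

section Kernels

variable {E F G P : Type*} [NormedAddCommGroup E] [NormedSpace ℝ E]
  [NormedAddCommGroup F] [NormedSpace ℝ F] [CompleteSpace F]
  [NormedAddCommGroup G] [NormedSpace ℝ G]
  [NormedAddCommGroup P] [NormedSpace ℝ P]

/-- If `A z ∘ R` is the identity at `y`, it is invertible near `y`. -/
theorem eventually_isInvertible_comp {A : E → E →L[ℝ] F} {R : F →L[ℝ] E} {y : E}
    (hA : ContinuousAt A y) (hR : (A y).comp R = .id ℝ F) :
    ∀ᶠ z in 𝓝 y, ((A z).comp R).IsInvertible := by
  have h1 : ContinuousAt (fun z ↦ (A z).comp R) y := hA.clm_comp continuousAt_const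
  have := ContinuousLinearEquiv.nhds (ContinuousLinearEquiv.refl ℝ F)
  refine h1.eventually_mem (s := range ((↑) : (F ≃L[ℝ] F) → F →L[ℝ] F)) ?_
  rw [hR]
  exact this

theorem contDiffAt_inverse_comp {A : E → E →L[ℝ] F} {R : F →L[ℝ] E} {y : E} {n : ℕ∞ω}
    (hA : ContDiffAt ℝ n A y) (hR : ((A y).comp R).IsInvertible) :
    ContDiffAt ℝ n (fun z ↦ ((A z).comp R).inverse) y := by
  obtain ⟨e, he⟩ := hR
  have h1 : ContDiffAt ℝ n (fun z ↦ (A z).comp R) y := hA.clm_comp contDiffAt_const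
  have h2 : ContDiffAt ℝ n ContinuousLinearMap.inverse ((A y).comp R) := by
    rw [← he]; exact contDiffAt_map_inverse e
  exact h2.comp y h1

/-- If a form `β` vanishes on the kernel of a closed form `A` that is onto at `y`, then `dβ`
vanishes on that kernel. -/
theorem flatD_eq_zero_of_ker_le {A : E → E →L[ℝ] F} {β : E → E →L[ℝ] G} {y : E}
    (hA : ContDiffAt ℝ 1 A y) (hβ : DifferentiableAt ℝ β y) {R : F →L[ℝ] E}
    (hR : (A y).comp R = .id ℝ F) (hker : ∀ᶠ z in 𝓝 y, ∀ v, A z v = 0 → β z v = 0) {v w : E}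
    (hv : A y v = 0) (hw : A y w = 0) (hcl : flatD A y v w = 0) : flatD β y v w = 0 := by
  have hinv := eventually_isInvertible_comp hA.continuousAt hR
  have hC : DifferentiableAt ℝ (fun z ↦ (β z).comp (R.comp ((A z).comp R).inverse)) y :=
    hβ.clm_comp ((differentiableAt_const R).clm_comp
      ((contDiffAt_inverse_comp hA hinv.self_of_nhds).differentiableAt (by simp)))
  -- Since `β` vanishes on the kernel of `A`, it factors as `β = C A` with `C` differentiable. Then
  -- `dβ = dC ∧ A + C dA`, and both terms vanish on `v`, `w`.
  have heq : β =ᶠ[𝓝 y] fun z ↦ ((β z).comp (R.comp ((A z).comp R).inverse)).comp (A z) := by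
    filter_upwards [hinv, hker] with z hz hk
    ext u
    have h1 : A z (u - R (((A z).comp R).inverse (A z u))) = 0 := by
      have : ((A z).comp R) (((A z).comp R).inverse (A z u)) = A z u := by
        rw [← ContinuousLinearMap.comp_apply, hz.self_comp_inverse]; rfl
      rw [map_sub, sub_eq_zero]
      exact this.symm
    simpa [sub_eq_zero] using hk _ h1
  rw [flatD_congr heq, flatD_clm_comp hC (hA.differentiableAt (by simp)), hv, hw, hcl]
  simp

/-- Frobenius theorem on a normed space: if `dB` vanishes on the kernels of the surjective maps
`B y`, there is an immersion through any point whose tangent spaces are these kernels. -/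
theorem exists_integral_immersion [CompleteSpace E] {B : E → E →L[ℝ] F} {s : Set E} (hs : IsOpen s)
    (hB : ContDiffOn ℝ ∞ B s) {x₀ : E} (hx₀ : x₀ ∈ s) {R : F →L[ℝ] E}
    (hR : (B x₀).comp R = .id ℝ F) (i : P →L[ℝ] E) (hi : Function.Injective i)
    (hirange : ∀ v, B x₀ v = 0 ↔ v ∈ range i)
    (hinv : ∀ y ∈ s, ∀ v w, B y v = 0 → B y w = 0 → flatD B y v w = 0) :
    ∃ (φ : P → E) (u : Set P), IsOpen u ∧ 0 ∈ u ∧ φ 0 = x₀ ∧ MapsTo φ u s ∧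
      ContDiffOn ℝ ∞ φ u ∧ ∀ p ∈ u, Function.Injective (fderiv ℝ φ p) ∧
        ∀ v, B (φ p) v = 0 ↔ v ∈ range (fderiv ℝ φ p) := by
  have hBat : ∀ y ∈ s, ContDiffAt ℝ ∞ B y := fun y hy ↦ hB.contDiffAt (hs.mem_nhds hy)
  set t : Set E := {y | y ∈ s ∧ ((B y).comp R).IsInvertible} with ht
  have htopen : IsOpen t := by
    rw [isOpen_iff_mem_nhds]
    rintro y ⟨hy, e, he⟩
    have h1 : ContinuousAt (fun z ↦ (B z).comp R) y :=
      (hBat y hy).continuousAt.clm_comp continuousAt_const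
    refine inter_mem (hs.mem_nhds hy)
      (h1.eventually_mem (s := range ((↑) : (F ≃L[ℝ] F) → F →L[ℝ] F)) ?_)
    rw [← he]
    exact e.nhds
  have hx₀t : x₀ ∈ t := ⟨hx₀, by rw [hR]; exact ⟨.refl ℝ F, rfl⟩⟩
  -- `A y` parametrizes the kernel of `B y`: it corrects `i` by a vector in the range of `R`, a
  -- complement of the kernel. Integral surfaces, as graphs over the kernel at `x₀`, then solve `φ'
  -- = A ∘ φ`.
  set A : E → P →L[ℝ] E := fun y ↦
    i - (R.comp ((B y).comp R).inverse).comp ((B y).comp i) with hAdef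
  have hA : ∀ y ∈ t, ContDiffAt ℝ ∞ A y := fun y hy ↦
    contDiffAt_const.sub ((contDiffAt_const.clm_comp
      (contDiffAt_inverse_comp (hBat y hy.1) hy.2)).clm_comp
        ((hBat y hy.1).clm_comp contDiffAt_const))
  have hBA : ∀ y ∈ t, (B y).comp (A y) = 0 := by
    intro y hy
    ext k
    have : ((B y).comp R) (((B y).comp R).inverse (B y (i k))) = B y (i k) := by
      rw [← ContinuousLinearMap.comp_apply, hy.2.self_comp_inverse]; rfl
    simpa [hAdef, sub_eq_zero] using this.symm
  -- The projection onto the kernel of `B x₀` along the range of `R`. It undoes the correction in `A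
  -- y`, and its kernel meets that of `B y` only in `0`.
  set π : E →L[ℝ] E := .id ℝ E - R.comp (B x₀) with hπ
  have hB0R : ∀ f, B x₀ (R f) = f := fun f ↦ DFunLike.congr_fun hR f
  have hπA : ∀ y, π.comp (A y) = i := by
    intro y
    ext k
    have h0 : B x₀ (i k) = 0 := (hirange _).2 ⟨k, rfl⟩
    simp [hπ, hAdef, h0, hB0R]
  have hzero : ∀ y ∈ t, ∀ u, π u = 0 → B y u = 0 → u = 0 := by
    intro y hy u hu hBu
    have h1 : u = R (B x₀ u) := by simpa [hπ, sub_eq_zero] using hu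
    have h2 : ((B y).comp R) (B x₀ u) = 0 := by
      rw [ContinuousLinearMap.comp_apply, ← h1, hBu]
    rw [h1, hy.2.injective (h2.trans (map_zero _).symm), map_zero]
  -- The difference of the two sides is killed by `π`, because `π ∘ A y` is constant in `y`, and by
  -- `B y`: differentiating `B A = 0` turns its image into `-dB (A h, A k)`.
  have hsymm : ∀ y ∈ t, ∀ h k, fderiv ℝ A y (A y h) k = fderiv ℝ A y (A y k) h := by
    intro y hy h k
    have hAd : DifferentiableAt ℝ A y := (hA y hy).differentiableAt (by simp)
    have hBd : DifferentiableAt ℝ B y := (hBat y hy.1).differentiableAt (by simp)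
    have d1 : ∀ v h, fderiv ℝ B y v (A y h) + B y (fderiv ℝ A y v h) = 0 := by
      intro v h
      have e : (fun z ↦ (B z).comp (A z)) =ᶠ[𝓝 y] fun _ ↦ 0 :=
        (htopen.eventually_mem hy).mono hBA
      have := e.fderiv_eq (𝕜 := ℝ)
      rw [fderiv_clm_comp hBd hAd] at this
      have := DFunLike.congr_fun (DFunLike.congr_fun this v) h
      simpa [add_comm] using this
    have d2 : ∀ v h, π (fderiv ℝ A y v h) = 0 := by
      intro v h
      have e : (fun z ↦ π.comp (A z)) = fun _ ↦ i := funext hπA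
      have := congrArg (fun g ↦ fderiv ℝ g y) e
      simp only [fderiv_clm_comp (differentiableAt_const π) hAd] at this
      simpa using DFunLike.congr_fun (DFunLike.congr_fun this v) h
    rw [← sub_eq_zero]
    refine hzero y hy _ (by rw [map_sub, d2, d2, sub_zero]) ?_
    have hBv : ∀ h, B y (A y h) = 0 := fun h ↦ DFunLike.congr_fun (hBA y hy) h
    have := hinv y hy.1 _ _ (hBv h) (hBv k)
    rw [flatD] at this
    rw [map_sub, eq_neg_of_add_eq_zero_right (d1 (A y h) k),
      eq_neg_of_add_eq_zero_right (d1 (A y k) h), ← neg_sub,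
      neg_sub_neg, neg_sub, ← neg_sub, this, neg_zero]
  obtain ⟨φ, r, hr, hφ0, hφ⟩ := exists_total_solution ((hA x₀ hx₀t).of_le (by norm_cast))
    (htopen.mem_nhds hx₀t) hsymm
  refine ⟨φ, ball 0 r, isOpen_ball, mem_ball_self hr, hφ0, fun p hp ↦ (hφ p hp).1.1,
    contDiffOn_of_hasFDerivAt_comp (fun y hy ↦ (hA y hy).contDiffWithinAt) isOpen_ball hφ,
    fun p hp ↦ ?_⟩
  have hpt := (hφ p hp).1
  rw [(hφ p hp).2.fderiv]
  have hπA' : ∀ k, π (A (φ p) k) = i k := fun k ↦ DFunLike.congr_fun (hπA (φ p)) k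
  refine ⟨fun h k hhk ↦ hi ?_, fun v ↦ ⟨fun hv ↦ ?_, ?_⟩⟩
  · rw [← hπA', ← hπA', hhk]
  · have h0 : B x₀ (π v) = 0 := by simp [hπ, hB0R]
    obtain ⟨k, hk⟩ := (hirange _).1 h0
    refine ⟨k, ?_⟩
    rw [eq_comm, ← sub_eq_zero]
    refine hzero _ hpt _ (by rw [map_sub, hπA', hk, sub_self]) ?_
    rw [map_sub, hv, zero_sub, neg_eq_zero]
    exact DFunLike.congr_fun (hBA _ hpt) k
  · rintro ⟨k, rfl⟩
    exact DFunLike.congr_fun (hBA _ hpt) k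

end Kernels

/-! ### Forms on the manifold read in charts -/

section Charts

variable {M : Type*} [TopologicalSpace M] [ChartedSpace (EuclideanSpace ℝ (Fin 4)) M]

local notation "E4" => EuclideanSpace ℝ (Fin 4)

/-- The derivative of the inverse of the chart at `x₀`, as an endomorphism of the model space. -/
noncomputable def chartSymmDeriv (x₀ : M) (y : E4) : E4 →L[ℝ] E4 :=
  (mfderiv (𝓡 4) (𝓡 4) (extChartAt (𝓡 4) x₀).symm y :)

/-- The derivative of the chart at `x₀`, as an endomorphism of the model space. -/
noncomputable def chartDeriv (x₀ x : M) : E4 →L[ℝ] E4 :=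
  (mfderiv (𝓡 4) (𝓡 4) (extChartAt (𝓡 4) x₀) x :)

/-- A `1`-form as a function with values in the dual of the model space. -/
noncomputable def modelForm (α : OneForm M) : M → E4 →L[ℝ] ℝ := α

theorem chartRep_eq (α : OneForm M) (x₀ : M) (y : E4) : chartRep α x₀ y =
    (modelForm α ((extChartAt (𝓡 4) x₀).symm y)).comp (chartSymmDeriv x₀ y) := rfl

theorem chartSymmDeriv_eq_mfderivWithin (x₀ : M) (y : E4) : chartSymmDeriv x₀ y =
    (mfderivWithin (𝓡 4) (𝓡 4) (extChartAt (𝓡 4) x₀).symm (range (𝓡 4)) y :) := by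
  simp only [chartSymmDeriv, modelWithCornersSelf_coe, range_id, mfderivWithin_univ]
  rfl

theorem eventually_mem_chart_target {x₁ x : M} (h₁ : x ∈ (extChartAt (𝓡 4) x₁).source)
    {s : Set M} (hs : s ∈ 𝓝 x) : ∀ᶠ z in 𝓝 (extChartAt (𝓡 4) x₁ x),
      z ∈ (extChartAt (𝓡 4) x₁).target ∧ (extChartAt (𝓡 4) x₁).symm z ∈ s := by
  refine ((isOpen_extChartAt_target x₁).eventually_mem
    ((extChartAt (𝓡 4) x₁).map_source h₁)).and ?_
  refine (continuousAt_extChartAt_symm' h₁).eventually_mem ?_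
  rwa [(extChartAt (𝓡 4) x₁).left_inv h₁]

variable [IsManifold (𝓡 4) ∞ M]

theorem isManifold_one : IsManifold (𝓡 4) 1 M :=
  IsManifold.of_le (n := ∞) (by norm_cast)

/-- The tangent space at `x` is identified with the model space through the preferred chart at `x`.
-/
theorem chartDeriv_self (x : M) : chartDeriv x x = .id ℝ E4 := by
  have := isManifold_one (M := M)
  exact mfderiv_extChartAt_self

theorem chartSymmDeriv_chartDeriv {x₀ x : M} (hx : x ∈ (extChartAt (𝓡 4) x₀).source) (v : E4) :
    chartSymmDeriv x₀ (extChartAt (𝓡 4) x₀ x) (chartDeriv x₀ x v) = v := by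
  have := isManifold_one (M := M)
  rw [chartSymmDeriv_eq_mfderivWithin]
  exact DFunLike.congr_fun (mfderivWithin_extChartAt_symm_comp_mfderiv_extChartAt' hx) v

theorem chartDeriv_chartSymmDeriv {x₀ x : M} (hx : x ∈ (extChartAt (𝓡 4) x₀).source) (v : E4) :
    chartDeriv x₀ x (chartSymmDeriv x₀ (extChartAt (𝓡 4) x₀ x) v) = v := by
  have := isManifold_one (M := M)
  rw [chartSymmDeriv_eq_mfderivWithin]
  exact DFunLike.congr_fun (mfderiv_extChartAt_comp_mfderivWithin_extChartAt_symm' hx) v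

theorem chartRep_chartDeriv (α : OneForm M) {x₀ x : M} (hx : x ∈ (extChartAt (𝓡 4) x₀).source)
    (v : E4) : chartRep α x₀ (extChartAt (𝓡 4) x₀ x) (chartDeriv x₀ x v) = modelForm α x v := by
  rw [chartRep_eq, ContinuousLinearMap.comp_apply, chartSymmDeriv_chartDeriv hx,
    (extChartAt (𝓡 4) x₀).left_inv hx]

theorem mdifferentiableAt_chart_symm (x₀ : M) {y : E4} (hy : y ∈ (extChartAt (𝓡 4) x₀).target) :
    MDifferentiableAt (𝓡 4) (𝓡 4) (extChartAt (𝓡 4) x₀).symm y := by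
  have := isManifold_one (M := M)
  simpa [mdifferentiableWithinAt_univ] using mdifferentiableWithinAt_extChartAt_symm (I := 𝓡 4) hy

/-- The derivative at `x` of a map to a normed space, as a linear map on the model space. -/
noncomputable def modelDeriv {G : Type*} [NormedAddCommGroup G] [NormedSpace ℝ G] (f : M → G)
    (x : M) : E4 →L[ℝ] G :=
  (mfderiv (𝓡 4) 𝓘(ℝ, G) f x :)

/-- The derivative of a map out of `M` read in the chart at `x`. -/
theorem fderiv_comp_chart_symm {G : Type*} [NormedAddCommGroup G] [NormedSpace ℝ G] {f : M → G}
    {x₀ x : M} (hx : x ∈ (extChartAt (𝓡 4) x₀).source)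
    (hf : MDifferentiableAt (𝓡 4) 𝓘(ℝ, G) f x) (v : E4) :
    fderiv ℝ (f ∘ (extChartAt (𝓡 4) x₀).symm) (extChartAt (𝓡 4) x₀ x) v =
      modelDeriv f x (chartSymmDeriv x₀ (extChartAt (𝓡 4) x₀ x) v) := by
  have hl := (extChartAt (𝓡 4) x₀).left_inv hx
  have h1 := mdifferentiableAt_chart_symm x₀ ((extChartAt (𝓡 4) x₀).map_source hx)
  have h2 : HasMFDerivAt (𝓡 4) 𝓘(ℝ, G) f ((extChartAt (𝓡 4) x₀).symm (extChartAt (𝓡 4) x₀ x))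
      (mfderiv (𝓡 4) 𝓘(ℝ, G) f x) := by
    rw [hl]; exact hf.hasMFDerivAt
  have h3 : HasFDerivAt (f ∘ (extChartAt (𝓡 4) x₀).symm)
      ((modelDeriv f x).comp (chartSymmDeriv x₀ (extChartAt (𝓡 4) x₀ x)))
      (extChartAt (𝓡 4) x₀ x) := (h2.comp _ h1.hasMFDerivAt).hasFDerivAt
  rw [h3.fderiv]
  rfl

/-- The transition from the chart at `x₁` to the chart at `x₀`. -/
noncomputable def chartChange (x₀ x₁ : M) (y : E4) : E4 :=
  extChartAt (𝓡 4) x₀ ((extChartAt (𝓡 4) x₁).symm y)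

theorem contDiffAt_chartChange {x₀ x₁ x : M} (h₀ : x ∈ (extChartAt (𝓡 4) x₀).source)
    (h₁ : x ∈ (extChartAt (𝓡 4) x₁).source) :
    ContDiffAt ℝ ∞ (chartChange x₀ x₁) (extChartAt (𝓡 4) x₁ x) := by
  have := contDiffWithinAt_ext_coord_change (I := 𝓡 4) (n := ∞) x₀ x₁
    (y := extChartAt (𝓡 4) x₁ x) (by
      simp only [PartialEquiv.trans_source, PartialEquiv.symm_source, mem_inter_iff, mem_preimage]
      exact ⟨(extChartAt (𝓡 4) x₁).map_source h₁, by rwa [(extChartAt (𝓡 4) x₁).left_inv h₁]⟩)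
  simp only [modelWithCornersSelf_coe, range_id, contDiffWithinAt_univ] at this
  exact this

/-- The chain rule for the transition map. Together with `flatD_pullback` it makes smoothness and
the exterior derivative independent of the chart. -/
theorem chartRep_eq_pullback (α : OneForm M) {x₀ x₁ x : M}
    (h₀ : x ∈ (extChartAt (𝓡 4) x₀).source) (h₁ : x ∈ (extChartAt (𝓡 4) x₁).source) :
    chartRep α x₁ =ᶠ[𝓝 (extChartAt (𝓡 4) x₁ x)] fun z ↦
      (chartRep α x₀ (chartChange x₀ x₁ z)).comp (fderiv ℝ (chartChange x₀ x₁) z) := by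
  filter_upwards [eventually_mem_chart_target h₁ ((isOpen_extChartAt_source x₀).mem_nhds h₀)]
    with z ⟨hz, hz'⟩
  have hz1 := (extChartAt (𝓡 4) x₁).map_target hz
  obtain ⟨m, hm, rfl⟩ : ∃ m ∈ (extChartAt (𝓡 4) x₁).source, extChartAt (𝓡 4) x₁ m = z :=
    ⟨_, hz1, (extChartAt (𝓡 4) x₁).right_inv hz⟩
  have := isManifold_one (M := M)
  rw [(extChartAt (𝓡 4) x₁).left_inv hm] at hz'
  ext v
  have h2 : MDifferentiableAt (𝓡 4) (𝓡 4) (extChartAt (𝓡 4) x₀) m :=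
    mdifferentiableAt_extChartAt (by simpa using hz')
  have h3 : fderiv ℝ (chartChange x₀ x₁) (extChartAt (𝓡 4) x₁ m) v =
      chartDeriv x₀ m (chartSymmDeriv x₁ (extChartAt (𝓡 4) x₁ m) v) :=
    fderiv_comp_chart_symm hm h2 v
  have h4 : chartChange x₀ x₁ (extChartAt (𝓡 4) x₁ m) = extChartAt (𝓡 4) x₀ m := by
    rw [chartChange, (extChartAt (𝓡 4) x₁).left_inv hm]
  rw [ContinuousLinearMap.comp_apply, h3, h4, chartRep_chartDeriv α hz', chartRep_eq,
    (extChartAt (𝓡 4) x₁).left_inv hm]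
  rfl

/-- A smooth form has a smooth expression in every chart. -/
theorem SmoothFormOn.contDiffAt_chartRep {α : OneForm M} {U : Set M} (hα : SmoothFormOn α U)
    {x₀ x : M} (hx : x ∈ U) (h₀ : x ∈ (extChartAt (𝓡 4) x₀).source) :
    ContDiffAt ℝ ∞ (chartRep α x₀) (extChartAt (𝓡 4) x₀ x) := by
  have h₁ := mem_extChartAt_source (I := 𝓡 4) x
  have hc := contDiffAt_chartChange h₁ h₀
  refine ContDiffAt.congr_of_eventuallyEq ?_ (chartRep_eq_pullback α h₁ h₀)
  refine ContDiffAt.clm_comp (ContDiffAt.comp (g := chartRep α x) _ ?_ hc)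
    (hc.fderiv_right (by simp))
  have h4 : chartChange x x₀ (extChartAt (𝓡 4) x₀ x) = extChartAt (𝓡 4) x x := by
    rw [chartChange, (extChartAt (𝓡 4) x₀).left_inv h₀]
  rw [h4]
  exact hα x hx

/-- The exterior derivative of a `1`-form, on vectors of the model space. -/
noncomputable def modelD (α : OneForm M) (x : M) (v w : E4) : ℝ := extD α x v w

theorem modelD_eq_flatD {α : OneForm M} {x : M}
    (hα : DifferentiableAt ℝ (chartRep α x) (extChartAt (𝓡 4) x x)) (v w : E4) :
    modelD α x v w = flatD (chartRep α x) (extChartAt (𝓡 4) x x) v w := by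
  have hd : DifferentiableAt ℝ (fun y => ContinuousAlternatingMap.ofSubsingleton ℝ E4 ℝ (0 : Fin 1)
      (chartRep α x y)) (extChartAt (𝓡 4) x x) :=
    (ContinuousAlternatingMap.ofSubsingletonLIE (𝕜 := ℝ) (E := E4)
      (F := ℝ) (0 : Fin 1)).differentiable.differentiableAt.comp
        _ hα
  have h1 : modelD α x v w = extDeriv (fun y => ContinuousAlternatingMap.ofSubsingleton ℝ E4 ℝ
      (0 : Fin 1) (chartRep α x y)) (extChartAt (𝓡 4) x x)
        ![chartDeriv x x v, chartDeriv x x w] := rfl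
  rw [h1, extDeriv_apply hd, chartDeriv_self]
  have h2 : ∀ v w, fderiv ℝ (fun y ↦ chartRep α x y w) (extChartAt (𝓡 4) x x) v =
      fderiv ℝ (chartRep α x) (extChartAt (𝓡 4) x x) v w := fun v w ↦ by
    rw [fderiv_clm_apply hα (differentiableAt_const w)]
    simp
  rw [Fin.sum_univ_two]
  simp only [Fin.val_zero, Fin.val_one, pow_zero, pow_one, one_smul, neg_smul]
  change fderiv ℝ (fun y ↦ chartRep α x y w) (extChartAt (𝓡 4) x x) v +
    -fderiv ℝ (fun y ↦ chartRep α x y v) (extChartAt (𝓡 4) x x) w = _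
  rw [h2, h2, flatD, sub_eq_add_neg]

/-- The exterior derivative can be computed in every chart. -/
theorem modelD_eq_flatD_of_mem_source {α : OneForm M} {U : Set M} (hα : SmoothFormOn α U)
    {x₀ x : M} (hx : x ∈ U) (h₀ : x ∈ (extChartAt (𝓡 4) x₀).source) (v w : E4) :
    modelD α x v w = flatD (chartRep α x₀) (extChartAt (𝓡 4) x₀ x)
      (chartDeriv x₀ x v) (chartDeriv x₀ x w) := by
  have := isManifold_one (M := M)
  have h₁ := mem_extChartAt_source (I := 𝓡 4) x
  have h4 : chartChange x₀ x (extChartAt (𝓡 4) x x) = extChartAt (𝓡 4) x₀ x := by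
    rw [chartChange, (extChartAt (𝓡 4) x).left_inv h₁]
  have h2 : MDifferentiableAt (𝓡 4) (𝓡 4) (extChartAt (𝓡 4) x₀) x :=
    mdifferentiableAt_extChartAt (by simpa using h₀)
  have h5 : ∀ v : E4, chartSymmDeriv x (extChartAt (𝓡 4) x x) v = v := fun v ↦ by
    have := chartSymmDeriv_chartDeriv h₁ v
    rwa [chartDeriv_self] at this
  have h3 : ∀ v : E4, fderiv ℝ (chartChange x₀ x) (extChartAt (𝓡 4) x x) v =
      chartDeriv x₀ x v := fun v ↦ (fderiv_comp_chart_symm h₁ h2 v).trans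
    (congrArg (chartDeriv x₀ x) (h5 v))
  rw [modelD_eq_flatD ((hα x hx).differentiableAt (by simp)),
    flatD_congr (chartRep_eq_pullback α h₀ h₁), flatD_pullback
      (by rw [h4]; exact (hα.contDiffAt_chartRep hx h₀).differentiableAt (by simp))
      ((contDiffAt_chartChange h₀ h₁).of_le (by norm_cast)), h4, h3, h3]

end Charts

/-! ### Leibniz rule, integral manifolds and the Frobenius theorem on the manifold -/

section Forms

variable {M : Type*} [TopologicalSpace M] [ChartedSpace (EuclideanSpace ℝ (Fin 4)) M]

local notation "E4" => EuclideanSpace ℝ (Fin 4)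
local notation "E2" => EuclideanSpace ℝ (Fin 2)

/-- The derivative of a parametrized surface, with values in the model space. -/
noncomputable def surfaceDeriv (φ : E2 → M) (t : E2) : E2 →L[ℝ] E4 :=
  (mfderiv (𝓡 2) (𝓡 4) φ t :)

/-- A combination of `1`-forms with function coefficients. -/
noncomputable def formSum {ι : Type*} [Fintype ι] (f : ι → M → ℝ) (θ : ι → OneForm M) : OneForm M :=
  fun x ↦ ∑ i, f i x • θ i x

theorem modelForm_formSum {ι : Type*} [Fintype ι] (f : ι → M → ℝ) (θ : ι → OneForm M) (x : M) :
    modelForm (formSum f θ) x = ∑ i, f i x • modelForm (θ i) x := rfl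

theorem chartRep_formSum {ι : Type*} [Fintype ι] (f : ι → M → ℝ) (θ : ι → OneForm M) (x₀ : M) :
    chartRep (formSum f θ) x₀ =
      fun y ↦ ∑ i, (f i ∘ (extChartAt (𝓡 4) x₀).symm) y • chartRep (θ i) x₀ y := by
  ext y v
  simp [chartRep_eq, modelForm_formSum]

/-- Smoothness of a function on `U`, read in the preferred charts. -/
def SmoothFunOn (f : M → ℝ) (U : Set M) : Prop :=
  ∀ x ∈ U, ContDiffAt ℝ ∞ (f ∘ (extChartAt (𝓡 4) x).symm) (extChartAt (𝓡 4) x x)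

theorem SmoothFormOn.formSum {ι : Type*} [Fintype ι] {f : ι → M → ℝ} {θ : ι → OneForm M} {U : Set M}
    (hf : ∀ i, SmoothFunOn (f i) U) (hθ : ∀ i, SmoothFormOn (θ i) U) :
    SmoothFormOn (formSum f θ) U := by
  intro x hx
  rw [chartRep_formSum]
  exact ContDiffAt.sum fun i _ ↦ (hf i x hx).smul (hθ i x hx)

theorem mdifferentiableAt_of_contMDiffOn {G : Type*} [NormedAddCommGroup G] [NormedSpace ℝ G]
    {f : M → G} {U : Set M} (hU : IsOpen U) (hf : ContMDiffOn (𝓡 4) 𝓘(ℝ, G) ∞ f U) {x : M}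
    (hx : x ∈ U) : MDifferentiableAt (𝓡 4) 𝓘(ℝ, G) f x :=
  (hf.contMDiffAt (hU.mem_nhds hx)).mdifferentiableAt (by simp)

variable [IsManifold (𝓡 4) ∞ M]

theorem contDiffAt_comp_chart_symm {G : Type*} [NormedAddCommGroup G] [NormedSpace ℝ G]
    {f : M → G} {x : M} (hf : ContMDiffAt (𝓡 4) 𝓘(ℝ, G) ∞ f x) :
    ContDiffAt ℝ ∞ (f ∘ (extChartAt (𝓡 4) x).symm) (extChartAt (𝓡 4) x x) := by
  have h1 : ContMDiffAt (𝓡 4) (𝓡 4) ∞ (extChartAt (𝓡 4) x).symm (extChartAt (𝓡 4) x x) :=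
    (contMDiffOn_extChartAt_symm x).contMDiffAt
      ((isOpen_extChartAt_target x).mem_nhds (mem_extChartAt_target x))
  refine (ContMDiffAt.comp (extChartAt (𝓡 4) x x) (g := f) ?_ h1).contDiffAt
  rwa [(extChartAt (𝓡 4) x).left_inv (mem_extChartAt_source x)]

theorem smoothFunOn_iff {f : M → ℝ} {U : Set M} (hU : IsOpen U) :
    SmoothFunOn f U ↔ ContMDiffOn (𝓡 4) 𝓘(ℝ) ∞ f U := by
  refine forall₂_congr fun x hx ↦ ?_
  constructor
  · intro h
    refine ContMDiffAt.contMDiffWithinAt ?_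
    have h2 : ContMDiffAt (𝓡 4) 𝓘(ℝ) ∞
        ((f ∘ (extChartAt (𝓡 4) x).symm) ∘ extChartAt (𝓡 4) x) x :=
      h.contMDiffAt.comp x contMDiffAt_extChartAt
    refine h2.congr_of_eventuallyEq ?_
    filter_upwards [extChartAt_source_mem_nhds (I := 𝓡 4) x] with y hy
    simp only [Function.comp_apply, (extChartAt (𝓡 4) x).left_inv hy]
  · intro h
    exact contDiffAt_comp_chart_symm (h.contMDiffAt (hU.mem_nhds hx))

theorem chartSymmDeriv_self (x : M) (v : E4) :
    chartSymmDeriv x (extChartAt (𝓡 4) x x) v = v := by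
  have := chartSymmDeriv_chartDeriv (mem_extChartAt_source (I := 𝓡 4) x) v
  rwa [chartDeriv_self] at this

theorem chartRep_self (α : OneForm M) (x : M) :
    chartRep α x (extChartAt (𝓡 4) x x) = modelForm α x := by
  ext v
  have := chartRep_chartDeriv α (mem_extChartAt_source (I := 𝓡 4) x) v
  rwa [chartDeriv_self] at this

/-- The Leibniz rule for the exterior derivative of a combination of `1`-forms. -/
theorem modelD_formSum {ι : Type*} [Fintype ι] {f : ι → M → ℝ} {θ : ι → OneForm M} {U : Set M}
    (hU : IsOpen U) (hf : ∀ i, ContMDiffOn (𝓡 4) 𝓘(ℝ) ∞ (f i) U)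
    (hθ : ∀ i, SmoothFormOn (θ i) U) {x : M} (hx : x ∈ U) (v w : E4) :
    modelD (formSum f θ) x v w = ∑ i, (modelDeriv (f i) x v * modelForm (θ i) x w -
      modelDeriv (f i) x w * modelForm (θ i) x v + f i x * modelD (θ i) x v w) := by
  have hs : ∀ i, SmoothFunOn (f i) U := fun i ↦ (smoothFunOn_iff hU).2 (hf i)
  have hfd : ∀ i, DifferentiableAt ℝ (f i ∘ (extChartAt (𝓡 4) x).symm) (extChartAt (𝓡 4) x x) :=
    fun i ↦ (hs i x hx).differentiableAt (by simp)
  have hθd : ∀ i, DifferentiableAt ℝ (chartRep (θ i) x) (extChartAt (𝓡 4) x x) :=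
    fun i ↦ (hθ i x hx).differentiableAt (by simp)
  rw [modelD_eq_flatD ((SmoothFormOn.formSum hs hθ x hx).differentiableAt (by simp)),
    chartRep_formSum, flatD_sum (η := fun i y ↦ (f i ∘ (extChartAt (𝓡 4) x).symm) y • chartRep (θ i) x y)
      fun i _ ↦ (hfd i).smul (hθd i)]
  refine Finset.sum_congr rfl fun i _ ↦ ?_
  have hx' := mem_extChartAt_source (I := 𝓡 4) x
  rw [flatD_smul (hfd i) (hθd i), modelD_eq_flatD (hθd i), chartRep_self,
    fderiv_comp_chart_symm hx' (mdifferentiableAt_of_contMDiffOn hU (hf i) hx),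
    fderiv_comp_chart_symm hx' (mdifferentiableAt_of_contMDiffOn hU (hf i) hx),
    chartSymmDeriv_self, chartSymmDeriv_self, Function.comp_apply,
    (extChartAt (𝓡 4) x).left_inv hx']
  simp only [smul_eq_mul]

/-- The exterior derivative of a form vanishes on the tangent planes of its integral surfaces. -/
theorem modelD_eq_zero_of_surface {α : OneForm M} {U : Set M} (hα : SmoothFormOn α U)
    {φ : E2 → M} {V : Set E2} (hV : IsOpen V) (hφ : ContMDiffOn (𝓡 2) (𝓡 4) ∞ φ V)
    (hmaps : MapsTo φ V U) (h0 : ∀ t ∈ V, ∀ τ, modelForm α (φ t) (surfaceDeriv φ t τ) = 0)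
    {t : E2} (ht : t ∈ V) (τ σ : E2) :
    modelD α (φ t) (surfaceDeriv φ t τ) (surfaceDeriv φ t σ) = 0 := by
  have := isManifold_one (M := M)
  set x := φ t with hx
  have hxs := mem_extChartAt_source (I := 𝓡 4) x
  set ψ : E2 → E4 := fun s ↦ extChartAt (𝓡 4) x (φ s) with hψdef
  have hφt : ∀ s ∈ V, ContMDiffAt (𝓡 2) (𝓡 4) ∞ φ s := fun s hs ↦ hφ.contMDiffAt (hV.mem_nhds hs)
  have hψ : ContDiffAt ℝ ∞ ψ t :=
    (ContMDiffAt.comp t (contMDiffAt_extChartAt (I := 𝓡 4) (x := x)) (hφt t ht)).contDiffAt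
  have hnear : ∀ᶠ s in 𝓝 t, s ∈ V ∧ φ s ∈ (extChartAt (𝓡 4) x).source :=
    (hV.eventually_mem ht).and ((hφt t ht).continuousAt.eventually_mem
      (extChartAt_source_mem_nhds (I := 𝓡 4) x))
  have hder : ∀ s, s ∈ V → φ s ∈ (extChartAt (𝓡 4) x).source → ∀ τ,
      fderiv ℝ ψ s τ = chartDeriv x (φ s) (surfaceDeriv φ s τ) := by
    intro s hs hs' τ
    have h1 : MDifferentiableAt (𝓡 4) (𝓡 4) (extChartAt (𝓡 4) x) (φ s) :=
      mdifferentiableAt_extChartAt (by simpa using hs')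
    have h2 : HasFDerivAt ψ ((chartDeriv x (φ s)).comp (surfaceDeriv φ s)) s :=
      (h1.hasMFDerivAt.comp s ((hφt s hs).mdifferentiableAt (by simp)).hasMFDerivAt).hasFDerivAt
    rw [h2.fderiv]
    rfl
  -- The form pulls back to zero on the surface, so the pullback of its exterior derivative is zero
  -- as well.
  have hzero : (fun s ↦ (chartRep α x (ψ s)).comp (fderiv ℝ ψ s)) =ᶠ[𝓝 t] fun _ ↦ 0 := by
    filter_upwards [hnear] with s ⟨hs, hs'⟩
    ext τ
    rw [ContinuousLinearMap.comp_apply, hder s hs hs', hψdef, chartRep_chartDeriv α hs', h0 s hs]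
    rfl
  have hαd : DifferentiableAt ℝ (chartRep α x) (extChartAt (𝓡 4) x x) :=
    (hα x (hmaps ht)).differentiableAt (by simp)
  have hpb := flatD_pullback (η := chartRep α x) (ψ := ψ) (p := t) hαd
    (hψ.of_le (by norm_cast)) τ σ
  rw [flatD_congr hzero, hder t ht hxs, hder t ht hxs] at hpb
  rw [modelD_eq_flatD_of_mem_source hα (hmaps ht) hxs]
  refine hpb.symm.trans ?_
  simp [flatD]

/-- If the leaves of a foliation are integral manifolds of `α`, then `dα` vanishes on them. -/
theorem modelD_eq_zero_of_isFoliation {T : SubspaceField M} (hT : IsFoliation T) {α : OneForm M}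
    {U : Set M} (hU : IsOpen U) (hα : SmoothFormOn α U)
    (h0 : ∀ x ∈ U, ∀ v : E4, v ∈ T x → modelForm α x v = 0) {x : M} (hx : x ∈ U) {v w : E4}
    (hv : v ∈ T x) (hw : w ∈ T x) : modelD α x v w = 0 := by
  obtain ⟨V, u, hV, hxV, hu, hker⟩ := hT x
  have hxs := mem_extChartAt_source (I := 𝓡 4) x
  set f : E4 → E2 := u ∘ (extChartAt (𝓡 4) x).symm with hf
  have hud : ∀ y ∈ V, MDifferentiableAt (𝓡 4) (𝓡 2) u y := fun y hy ↦
    mdifferentiableAt_of_contMDiffOn hV hu hy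
  have hfs : ContDiffAt ℝ ∞ f (extChartAt (𝓡 4) x x) :=
    contDiffAt_comp_chart_symm (hu.contMDiffAt (hV.mem_nhds hxV))
  have hkermem : ∀ y ∈ V, ∀ v : E4, modelDeriv u y v = 0 ↔ v ∈ T y := by
    intro y hy v
    rw [(hker y hy).2]
    rfl
  have hfd : ∀ v, fderiv ℝ f (extChartAt (𝓡 4) x x) v = modelDeriv u x v := fun v ↦ by
    rw [hf, fderiv_comp_chart_symm hxs (hud x hxV), chartSymmDeriv_self]
  obtain ⟨R, hR⟩ := (fderiv ℝ f (extChartAt (𝓡 4) x x)).exists_rightInverse_of_surjective (by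
    rw [LinearMap.range_eq_top]
    intro y
    obtain ⟨v, hv⟩ := (hker x hxV).1 y
    exact ⟨v, (hfd v).trans hv⟩)
  rw [modelD_eq_flatD ((hα x hx).differentiableAt (by simp))]
  -- The leaves are the level sets of `f`, so `α` vanishes on the kernel of the closed form `df`.
  refine flatD_eq_zero_of_ker_le (A := fderiv ℝ f) (hfs.fderiv_right (by norm_cast))
    ((hα x hx).differentiableAt (by simp)) hR ?_ ?_ ?_ (flatD_fderiv (hfs.of_le (by norm_cast)) v w)
  · filter_upwards [eventually_mem_chart_target hxs (inter_mem (hV.mem_nhds hxV) (hU.mem_nhds hx))]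
      with z ⟨hz, hzV, hzU⟩ v hAv
    obtain ⟨m, hm, rfl⟩ : ∃ m ∈ (extChartAt (𝓡 4) x).source, extChartAt (𝓡 4) x m = z :=
      ⟨_, (extChartAt (𝓡 4) x).map_target hz, (extChartAt (𝓡 4) x).right_inv hz⟩
    rw [(extChartAt (𝓡 4) x).left_inv hm] at hzV hzU
    rw [hf, fderiv_comp_chart_symm hm (hud m hzV), hkermem m hzV] at hAv
    rw [chartRep_eq, (extChartAt (𝓡 4) x).left_inv hm]
    exact h0 m hzU _ hAv
  · rw [hfd, hkermem x hxV]; exact hv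
  · rw [hfd, hkermem x hxV]; exact hw

/-- Frobenius theorem for a codimension two distribution on a four-manifold. -/
theorem isIntegrableOn_of_modelD_eq_zero {α : Fin 2 → OneForm M} {U : Set M} (hU : IsOpen U)
    (hα : ∀ i, SmoothFormOn (α i) U)
    (hsurj : ∀ x ∈ U, Function.Surjective (ContinuousLinearMap.pi fun i ↦ modelForm (α i) x))
    (h0 : ∀ x ∈ U, ∀ v w : E4, (∀ i, modelForm (α i) x v = 0) → (∀ i, modelForm (α i) x w = 0) →
      ∀ i, modelD (α i) x v w = 0) :
    IsIntegrableOn (fun x ↦ (α 0 x).ker ⊓ (α 1 x).ker) U := by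
  have := isManifold_one (M := M)
  intro x hx
  have hxs := mem_extChartAt_source (I := 𝓡 4) x
  set e := extChartAt (𝓡 4) x with he
  set B : E4 → E4 →L[ℝ] (Fin 2 → ℝ) := fun z ↦ .pi fun i ↦ chartRep (α i) x z with hB
  set s : Set E4 := e.target ∩ e.symm ⁻¹' U with hs
  have hsopen : IsOpen s :=
    (continuousOn_extChartAt_symm x).isOpen_inter_preimage (isOpen_extChartAt_target x) hU
  have hpt : ∀ z ∈ s, ∃ m ∈ e.source, m ∈ U ∧ e m = z := fun z hz ↦
    ⟨e.symm z, e.map_target hz.1, hz.2, e.right_inv hz.1⟩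
  have hxmem : e x ∈ s := ⟨e.map_source hxs, by rwa [mem_preimage, e.left_inv hxs]⟩
  have hBsmooth : ContDiffOn ℝ ∞ B s := by
    intro z hz
    obtain ⟨m, hm, hmU, rfl⟩ := hpt z hz
    exact (contDiffAt_pi_form fun i ↦ (hα i).contDiffAt_chartRep hmU hm).contDiffWithinAt
  have hBx : B (e x) = .pi fun i ↦ modelForm (α i) x := by
    simp only [hB, he, chartRep_self]
  obtain ⟨R, hR⟩ := (B (e x)).exists_rightInverse_of_surjective (by
    rw [LinearMap.range_eq_top, hBx]; exact hsurj x hx)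
  have hfin : Module.finrank ℝ E2 = Module.finrank ℝ (B (e x)).ker := by
    have h1 := (B (e x) : E4 →ₗ[ℝ] (Fin 2 → ℝ)).finrank_range_add_finrank_ker
    rw [LinearMap.range_eq_top.2 (by rw [hBx]; exact hsurj x hx)] at h1
    simp only [finrank_top, Module.finrank_fintype_fun_eq_card, Fintype.card_fin,
      finrank_euclideanSpace] at h1 ⊢
    change 2 = Module.finrank ℝ (LinearMap.ker (B (e x) : E4 →ₗ[ℝ] (Fin 2 → ℝ)))
    omega
  -- Any linear parametrization of the two-dimensional kernel at the centre serves as the initial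
  -- tangent map.
  let ι : E2 →L[ℝ] E4 := (B (e x)).ker.subtypeL.comp
    (LinearEquiv.ofFinrankEq E2 (B (e x)).ker hfin).toLinearMap.toContinuousLinearMap
  have hi : Function.Injective ι :=
    Subtype.val_injective.comp (LinearEquiv.ofFinrankEq E2 (B (e x)).ker hfin).injective
  have hirange : ∀ v, B (e x) v = 0 ↔ v ∈ range ι := by
    intro v
    constructor
    · intro hv
      obtain ⟨t, ht⟩ := (LinearEquiv.ofFinrankEq E2 (B (e x)).ker hfin).surjective ⟨v, hv⟩
      exact ⟨t, congrArg Subtype.val ht⟩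
    · rintro ⟨t, rfl⟩
      exact (LinearEquiv.ofFinrankEq E2 (B (e x)).ker hfin t).2
  have hinv : ∀ y ∈ s, ∀ v w, B y v = 0 → B y w = 0 → flatD B y v w = 0 := by
    intro z hz v w hv hw
    obtain ⟨m, hm, hmU, rfl⟩ := hpt z hz
    rw [hB, flatD_pi fun i ↦ ((hα i).contDiffAt_chartRep hmU hm).differentiableAt (by simp)]
    have hrep : ∀ i v, chartRep (α i) x (e m) v =
        modelForm (α i) m (chartSymmDeriv x (e m) v) := fun i v ↦ by
      rw [chartRep_eq, ← he, e.left_inv hm]; rfl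
    have := h0 m hmU (chartSymmDeriv x (e m) v) (chartSymmDeriv x (e m) w)
      (fun i ↦ (hrep i v).symm.trans (congrFun hv i)) (fun i ↦ (hrep i w).symm.trans (congrFun hw i))
    ext i
    have h1 := this i
    rwa [modelD_eq_flatD_of_mem_source (hα i) hmU hm, chartDeriv_chartSymmDeriv hm,
      chartDeriv_chartSymmDeriv hm] at h1
  obtain ⟨φ, V, hV, h0V, hφ0, hmaps, hφ, himm⟩ :=
    exists_integral_immersion hsopen hBsmooth hxmem hR ι hi hirange hinv
  have hsymmd : ∀ t ∈ V, HasMFDerivAt (𝓡 2) (𝓡 4) (e.symm ∘ φ) t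
      ((mfderiv (𝓡 4) (𝓡 4) e.symm (φ t)).comp (mfderiv (𝓡 2) (𝓡 4) φ t)) := fun t ht ↦
    (mdifferentiableAt_chart_symm x (hmaps ht).1).hasMFDerivAt.comp t
      ((hφ.contDiffAt (hV.mem_nhds ht)).contMDiffAt.mdifferentiableAt (by simp)).hasMFDerivAt
  have hsd : ∀ t ∈ V, ∀ τ, surfaceDeriv (e.symm ∘ φ) t τ =
      chartSymmDeriv x (φ t) (fderiv ℝ φ t τ) := by
    intro t ht τ
    rw [← mfderiv_eq_fderiv]
    exact DFunLike.congr_fun (hsymmd t ht).mfderiv τ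
  refine ⟨V, e.symm ∘ φ, hV, h0V, by rw [Function.comp_apply, hφ0, e.left_inv hxs],
    fun t ht ↦ (hmaps ht).2, ?_, fun t ht ↦ ?_⟩
  · exact (contMDiffOn_extChartAt_symm x).comp hφ.contMDiffOn fun t ht ↦ (hmaps ht).1
  · obtain ⟨m, hm, hmU, hmt⟩ := hpt _ (hmaps ht)
    have hφt : (e.symm ∘ φ) t = m := by rw [Function.comp_apply, ← hmt, e.left_inv hm]
    have hform : ∀ v : E4, (∀ i, modelForm (α i) ((e.symm ∘ φ) t) v = 0) ↔
        v ∈ range (surfaceDeriv (e.symm ∘ φ) t) := by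
      intro v
      have h1 : (∀ i, modelForm (α i) m v = 0) ↔ B (φ t) (chartDeriv x m v) = 0 := by
        rw [← hmt, funext_iff]
        refine forall_congr' fun i ↦ ?_
        rw [← chartRep_chartDeriv (α i) hm v]
        rfl
      rw [hφt, h1, (himm t ht).2]
      constructor
      · rintro ⟨τ, hτ⟩
        refine ⟨τ, ?_⟩
        rw [hsd t ht, hτ, ← hmt, chartSymmDeriv_chartDeriv hm]
      · rintro ⟨τ, rfl⟩
        refine ⟨τ, ?_⟩
        rw [hsd t ht, ← hmt, chartDeriv_chartSymmDeriv hm]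
    have hinj : Function.Injective (surfaceDeriv (e.symm ∘ φ) t) := by
      intro τ σ h2
      rw [hsd t ht, hsd t ht, ← hmt] at h2
      refine (himm t ht).1 ?_
      rw [← chartDeriv_chartSymmDeriv hm (fderiv ℝ φ t τ), h2, chartDeriv_chartSymmDeriv hm]
    refine ⟨hinj, ?_⟩
    ext v
    refine (hform v).symm.trans ?_
    rw [Fin.forall_fin_two]
    rfl

end Forms

/-! ### Dual frames -/

section Frames

variable {M : Type*} [TopologicalSpace M] [ChartedSpace (EuclideanSpace ℝ (Fin 4)) M]

local notation "E4" => EuclideanSpace ℝ (Fin 4)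

theorem isInvertible_pi_of_injective {ι : Type*} [Fintype ι] (hι : Fintype.card ι = 4)
    {f : ι → E4 →L[ℝ] ℝ} (hf : ∀ v, (∀ c, f c v = 0) → v = 0) :
    (ContinuousLinearMap.pi f).IsInvertible := by
  have hinj : Function.Injective (ContinuousLinearMap.pi f : E4 →ₗ[ℝ] (ι → ℝ)) :=
    (injective_iff_map_eq_zero _).2 fun v hv ↦ hf v fun c ↦ congrFun hv c
  refine ⟨(LinearEquiv.ofInjectiveOfFinrankEq _ hinj
    (by simp [hι])).toContinuousLinearEquiv, ?_⟩
  ext v c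
  rfl

/-- The field of frames dual to a coframe. -/
noncomputable def dualFrame {ι : Type*} [DecidableEq ι] (κ : ι → OneForm M) (c : ι)
    (x : M) : E4 :=
  (ContinuousLinearMap.pi fun i ↦ modelForm (κ i) x).inverse (Pi.single c 1)

section

variable {ι : Type*} [Fintype ι] [DecidableEq ι] {κ : ι → OneForm M}

theorem modelForm_dualFrame (hι : Fintype.card ι = 4) {x : M}
    (hx : ∀ v, (∀ c, modelForm (κ c) x v = 0) → v = 0) (c d : ι) :
    modelForm (κ c) x (dualFrame κ d x) = if c = d then 1 else 0 := by
  have h := isInvertible_pi_of_injective hι hx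
  have h1 : (ContinuousLinearMap.pi fun i ↦ modelForm (κ i) x) (dualFrame κ d x) =
      Pi.single d 1 := by
    rw [dualFrame, ← ContinuousLinearMap.comp_apply, h.self_comp_inverse]
    rfl
  simpa [Pi.single_apply] using congrFun h1 c

theorem eq_sum_dualFrame (hι : Fintype.card ι = 4) {x : M}
    (hx : ∀ v, (∀ c, modelForm (κ c) x v = 0) → v = 0) (v : E4) :
    v = ∑ c, modelForm (κ c) x v • dualFrame κ c x := by
  rw [← sub_eq_zero]
  refine hx _ fun c ↦ ?_
  simp [modelForm_dualFrame hι hx]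

variable [IsManifold (𝓡 4) ∞ M]

/-- In a chart the dual frame is obtained by inverting the matrix of the coframe, and inversion is
smooth. This gives the smoothness of the connection forms and of the torsion. -/
theorem smoothFunOn_modelD_dualFrame (hι : Fintype.card ι = 4) {U : Set M} (hU : IsOpen U)
    (hκ : ∀ c, SmoothFormOn (κ c) U)
    (hinj : ∀ x ∈ U, ∀ v, (∀ c, modelForm (κ c) x v = 0) → v = 0) {α : OneForm M}
    (hα : SmoothFormOn α U) (c d : ι) :
    SmoothFunOn (fun x ↦ modelD α x (dualFrame κ c x) (dualFrame κ d x)) U := by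
  intro x hx
  have hxs := mem_extChartAt_source (I := 𝓡 4) x
  set B : E4 → E4 →L[ℝ] (ι → ℝ) := fun z ↦ .pi fun i ↦ chartRep (κ i) x z with hB
  have hBm : ∀ m ∈ (extChartAt (𝓡 4) x).source, m ∈ U → (B (extChartAt (𝓡 4) x m)).IsInvertible ∧
      ∀ c, (B (extChartAt (𝓡 4) x m)).inverse (Pi.single c 1) =
        chartDeriv x m (dualFrame κ c m) := by
    intro m hm hmU
    have hi : (B (extChartAt (𝓡 4) x m)).IsInvertible := by
      refine isInvertible_pi_of_injective hι fun v hv ↦ ?_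
      have h1 : chartSymmDeriv x (extChartAt (𝓡 4) x m) v = 0 := hinj m hmU _ fun c ↦ by
        have := hv c
        rwa [chartRep_eq, (extChartAt (𝓡 4) x).left_inv hm] at this
      rw [← chartDeriv_chartSymmDeriv hm v, h1, map_zero]
    refine ⟨hi, fun c ↦ ?_⟩
    have h2 : B (extChartAt (𝓡 4) x m) (chartDeriv x m (dualFrame κ c m)) = Pi.single c 1 := by
      ext i
      have : B (extChartAt (𝓡 4) x m) (chartDeriv x m (dualFrame κ c m)) i =
        modelForm (κ i) m (dualFrame κ c m) := chartRep_chartDeriv (κ i) hm _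
      rw [this, modelForm_dualFrame hι (hinj m hmU), Pi.single_apply]
    rw [← h2, ← ContinuousLinearMap.comp_apply, hi.inverse_comp_self]
    rfl
  have hBs : ContDiffAt ℝ ∞ B (extChartAt (𝓡 4) x x) := contDiffAt_pi_form fun i ↦ hκ i x hx
  have hBi : ContDiffAt ℝ ∞ (fun z ↦ (B z).inverse) (extChartAt (𝓡 4) x x) := by
    obtain ⟨e, he⟩ := (hBm x hxs hx).1
    have h2 : ContDiffAt ℝ ∞ ContinuousLinearMap.inverse (B (extChartAt (𝓡 4) x x)) := by
      rw [← he]; exact contDiffAt_map_inverse e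
    exact h2.comp (extChartAt (𝓡 4) x x) hBs
  have hv : ∀ c, ContDiffAt ℝ ∞ (fun z ↦ (B z).inverse (Pi.single c 1)) (extChartAt (𝓡 4) x x) :=
    fun c ↦ hBi.clm_apply contDiffAt_const
  have hd : ContDiffAt ℝ ∞ (fderiv ℝ (chartRep α x)) (extChartAt (𝓡 4) x x) :=
    (hα x hx).fderiv_right (by simp)
  have hmain : ContDiffAt ℝ ∞ (fun z ↦ flatD (chartRep α x) z ((B z).inverse (Pi.single c 1))
      ((B z).inverse (Pi.single d 1))) (extChartAt (𝓡 4) x x) :=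
    ((hd.clm_apply (hv c)).clm_apply (hv d)).sub ((hd.clm_apply (hv d)).clm_apply (hv c))
  refine hmain.congr_of_eventuallyEq ?_
  filter_upwards [eventually_mem_chart_target hxs (hU.mem_nhds hx)] with z ⟨hz, hzU⟩
  obtain ⟨m, hm, rfl⟩ : ∃ m ∈ (extChartAt (𝓡 4) x).source, extChartAt (𝓡 4) x m = z :=
    ⟨_, (extChartAt (𝓡 4) x).map_target hz, (extChartAt (𝓡 4) x).right_inv hz⟩
  rw [(extChartAt (𝓡 4) x).left_inv hm] at hzU
  rw [Function.comp_apply, (extChartAt (𝓡 4) x).left_inv hm, (hBm m hm hzU).2, (hBm m hm hzU).2,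
    modelD_eq_flatD_of_mem_source hα hzU hm]

end

/-- `e ξ i` is the frame dual to the coframe `θ 0 i`, `θ 1 i` on `U`. -/
structure IsDualFrame (U : Set M) (θ : Fin 3 → Fin 2 → OneForm M) (e : Fin 2 → Fin 2 → M → E4) :
    Prop where
  apply_zero_zero : ∀ x ∈ U, ∀ i j, modelForm (θ 0 i) x (e 0 j x) = if i = j then 1 else 0
  apply_zero_one : ∀ x ∈ U, ∀ i j, modelForm (θ 0 i) x (e 1 j x) = 0
  apply_one_zero : ∀ x ∈ U, ∀ i j, modelForm (θ 1 i) x (e 0 j x) = 0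
  apply_one_one : ∀ x ∈ U, ∀ i j, modelForm (θ 1 i) x (e 1 j x) = if i = j then 1 else 0
  expand : ∀ x ∈ U, ∀ v, v = modelForm (θ 0 0) x v • e 0 0 x + modelForm (θ 0 1) x v • e 0 1 x +
    (modelForm (θ 1 0) x v • e 1 0 x + modelForm (θ 1 1) x v • e 1 1 x)
  smooth : ∀ α, SmoothFormOn α U → ∀ ξ i η j, SmoothFunOn (fun x ↦ modelD α x (e ξ i x) (e η j x)) U

variable [IsManifold (𝓡 4) ∞ M]

theorem ThreeWeb.IsAdaptedCoframe.exists_isDualFrame {W : ThreeWeb M} {U : Set M} (hU : IsOpen U)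
    {θ : Fin 3 → Fin 2 → OneForm M} (hθ : W.IsAdaptedCoframe U θ) :
    ∃ e, IsDualFrame U θ e := by
  let κ : Fin 2 × Fin 2 → OneForm M := fun c ↦ θ c.1.castSucc c.2
  have hι : Fintype.card (Fin 2 × Fin 2) = 4 := by simp
  -- A vector killed by all four forms is tangent to leaves of two transversal foliations.
  have hinj : ∀ x ∈ U, ∀ v, (∀ c, modelForm (κ c) x v = 0) → v = 0 := by
    intro x hx v hv
    have h0 : v ∈ W.leafTangent 0 x := (hθ.leaf_iff 0 x hx v).2 fun i ↦ hv (0, i)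
    have h1 : v ∈ W.leafTangent 1 x := (hθ.leaf_iff 1 x hx v).2 fun i ↦ hv (1, i)
    exact Submodule.disjoint_def.1 (W.generalPosition 0 1 (by decide) x).disjoint v h0 h1
  have hap : ∀ x ∈ U, ∀ c d, modelForm (κ c) x (dualFrame κ d x) = if c = d then 1 else 0 :=
    fun x hx c d ↦ modelForm_dualFrame hι (hinj x hx) c d
  refine ⟨fun ξ i ↦ dualFrame κ (ξ, i), fun x hx i j ↦ ?_, fun x hx i j ↦ ?_, fun x hx i j ↦ ?_,
    fun x hx i j ↦ ?_, fun x hx v ↦ ?_, fun α hα ξ i η j ↦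
      smoothFunOn_modelD_dualFrame hι hU (fun c ↦ hθ.smooth _ _) hinj hα _ _⟩
  · exact (hap x hx (0, i) (0, j)).trans (by simp)
  · exact (hap x hx (0, i) (1, j)).trans (by simp)
  · exact (hap x hx (1, i) (0, j)).trans (by simp)
  · exact (hap x hx (1, i) (1, j)).trans (by simp)
  · have := eq_sum_dualFrame hι (hinj x hx) v
    rw [Fintype.sum_prod_type, Fin.sum_univ_two, Fin.sum_univ_two, Fin.sum_univ_two] at this
    exact this

theorem SmoothFormOn.exists_modelD_eq {α : OneForm M} {U : Set M} (hα : SmoothFormOn α U) {x : M}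
    (hx : x ∈ U) : ∃ L : E4 →ₗ[ℝ] E4 →ₗ[ℝ] ℝ, (∀ v, L v v = 0) ∧
      ∀ v w, modelD α x v w = L v w := by
  let D := fderiv ℝ (chartRep α x) (extChartAt (𝓡 4) x x)
  refine ⟨LinearMap.mk₂ ℝ (fun v w ↦ D v w - D w v) ?_ ?_ ?_ ?_, fun v ↦ ?_, fun v w ↦ ?_⟩
  · intro v v' w; simp; ring
  · intro c v w; simp; ring
  · intro v w w'; simp; ring
  · intro c v w; simp; ring
  · simp
  · rw [modelD_eq_flatD ((hα x hx).differentiableAt (by simp))]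
    rfl

/-- Expansion of the exterior derivative of a form in the dual frame. -/
theorem IsDualFrame.modelD_expand {U : Set M} {θ : Fin 3 → Fin 2 → OneForm M}
    {e : Fin 2 → Fin 2 → M → E4} (he : IsDualFrame U θ e) {α : OneForm M} (hα : SmoothFormOn α U)
    {x : M} (hx : x ∈ U) (v w : E4) :
    modelD α x v w =
      (modelForm (θ 0 0) x v * modelForm (θ 0 1) x w - modelForm (θ 0 1) x v * modelForm (θ 0 0) x w)
        * modelD α x (e 0 0 x) (e 0 1 x) +
      (modelForm (θ 0 0) x v * modelForm (θ 1 0) x w - modelForm (θ 1 0) x v * modelForm (θ 0 0) x w)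
        * modelD α x (e 0 0 x) (e 1 0 x) +
      (modelForm (θ 0 0) x v * modelForm (θ 1 1) x w - modelForm (θ 1 1) x v * modelForm (θ 0 0) x w)
        * modelD α x (e 0 0 x) (e 1 1 x) +
      (modelForm (θ 0 1) x v * modelForm (θ 1 0) x w - modelForm (θ 1 0) x v * modelForm (θ 0 1) x w)
        * modelD α x (e 0 1 x) (e 1 0 x) +
      (modelForm (θ 0 1) x v * modelForm (θ 1 1) x w - modelForm (θ 1 1) x v * modelForm (θ 0 1) x w)
        * modelD α x (e 0 1 x) (e 1 1 x) +
      (modelForm (θ 1 0) x v * modelForm (θ 1 1) x w - modelForm (θ 1 1) x v * modelForm (θ 1 0) x w)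
        * modelD α x (e 1 0 x) (e 1 1 x) := by
  obtain ⟨L, hLalt, hL⟩ := hα.exists_modelD_eq hx
  simp only [hL]
  have hanti : ∀ a b, L a b = -L b a := fun a b ↦ by
    have := hLalt (a + b)
    simp only [map_add, LinearMap.add_apply, hLalt] at this
    linarith
  conv_lhs => rw [he.expand x hx v, he.expand x hx w]
  simp only [map_add, map_smul, LinearMap.add_apply, LinearMap.smul_apply, smul_eq_mul, hLalt]
  rw [hanti (e 0 1 x) (e 0 0 x), hanti (e 1 0 x) (e 0 0 x), hanti (e 1 1 x) (e 0 0 x),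
    hanti (e 1 0 x) (e 0 1 x), hanti (e 1 1 x) (e 0 1 x), hanti (e 1 1 x) (e 1 0 x)]
  ring

end Frames

/-! ### Existence of the connection and the torsion covector -/

section Existence

variable {M : Type*} [TopologicalSpace M] [ChartedSpace (EuclideanSpace ℝ (Fin 4)) M]

local notation "E4" => EuclideanSpace ℝ (Fin 4)

theorem SmoothFunOn.neg {f : M → ℝ} {U : Set M} (hf : SmoothFunOn f U) :
    SmoothFunOn (fun x ↦ -f x) U :=
  fun x hx ↦ (hf x hx).neg

theorem SmoothFunOn.sub {f g : M → ℝ} {U : Set M} (hf : SmoothFunOn f U) (hg : SmoothFunOn g U) :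
    SmoothFunOn (fun x ↦ f x - g x) U :=
  fun x hx ↦ (hf x hx).sub (hg x hx)

theorem smoothFunOn_one (U : Set M) : SmoothFunOn (fun _ ↦ (1 : ℝ)) U :=
  fun _ _ ↦ contDiffAt_const

/-- The connection forms of a web in terms of the frame dual to an adapted coframe. -/
noncomputable def connectionForm (θ : Fin 3 → Fin 2 → OneForm M) (e : Fin 2 → Fin 2 → M → E4)
    (j i : Fin 2) : OneForm M :=
  formSum (fun (c : Fin 2 × Fin 2) x ↦
    if c.1 = 0 then -modelD (θ 1 i) x (e 0 c.2 x) (e 1 j x)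
    else modelD (θ 0 i) x (e 0 j x) (e 1 c.2 x)) fun c ↦ θ c.1.castSucc c.2

theorem modelForm_connectionForm (θ : Fin 3 → Fin 2 → OneForm M) (e : Fin 2 → Fin 2 → M → E4)
    (j i : Fin 2) (x : M) (v : E4) : modelForm (connectionForm θ e j i) x v =
      ∑ k, (-modelD (θ 1 i) x (e 0 k x) (e 1 j x) * modelForm (θ 0 k) x v) +
        ∑ k, modelD (θ 0 i) x (e 0 j x) (e 1 k x) * modelForm (θ 1 k) x v := by
  rw [connectionForm, modelForm_formSum, Fintype.sum_prod_type, Fin.sum_univ_two]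
  simp only [Fin.sum_univ_two]
  simp

/-- The torsion components of the first structure equation. -/
noncomputable def torsionAux (θ : Fin 3 → Fin 2 → OneForm M) (e : Fin 2 → Fin 2 → M → E4)
    (i : Fin 2) (x : M) : ℝ :=
  modelD (θ 0 i) x (e 0 0 x) (e 0 1 x) -
    (-modelD (θ 1 i) x (e 0 1 x) (e 1 0 x) - -modelD (θ 1 i) x (e 0 0 x) (e 1 1 x))

/-- The torsion covector of a web in terms of the frame dual to an adapted coframe. -/
noncomputable def torsionCovector (θ : Fin 3 → Fin 2 → OneForm M) (e : Fin 2 → Fin 2 → M → E4)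
    (i : Fin 2) (x : M) : ℝ :=
  if i = 0 then torsionAux θ e 1 x else -torsionAux θ e 0 x

theorem modelDeriv_const (x : M) (v : E4) : modelDeriv (fun _ : M ↦ (1 : ℝ)) x v = 0 := by
  have : modelDeriv (fun _ : M ↦ (1 : ℝ)) x = 0 := mfderiv_const
  rw [this]
  rfl

variable [IsManifold (𝓡 4) ∞ M]

/-- The integrability of the third foliation. -/
theorem ThreeWeb.IsAdaptedCoframe.modelD_third {W : ThreeWeb M} {U : Set M} (hU : IsOpen U)
    {θ : Fin 3 → Fin 2 → OneForm M} (hθ : W.IsAdaptedCoframe U θ) (i : Fin 2) {x : M} (hx : x ∈ U)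
    {v w : E4} (hv : ∀ j, modelForm (θ 0 j) x v + modelForm (θ 1 j) x v = 0)
    (hw : ∀ j, modelForm (θ 0 j) x w + modelForm (θ 1 j) x w = 0) :
    modelD (θ 0 i) x v w + modelD (θ 1 i) x v w = 0 := by
  have hsum : ∀ y ∈ U, ∀ j, ∀ u : E4, modelForm (θ 0 j) y u + modelForm (θ 1 j) y u +
      modelForm (θ 2 j) y u = 0 := fun y hy j u ↦ by
    have := hθ.sum_eq_zero j y hy u
    rw [Fin.sum_univ_three] at this
    exact this
  have hmem : ∀ y ∈ U, ∀ u : E4, u ∈ W.leafTangent 2 y ↔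
      ∀ j, modelForm (θ 0 j) y u + modelForm (θ 1 j) y u = 0 := fun y hy u ↦ by
    refine (hθ.leaf_iff 2 y hy u).trans (forall_congr' fun j ↦ ?_)
    have h1 := hsum y hy j u
    have h2 : (θ 2 j y : TangentSpace (𝓡 4) y → ℝ) u = modelForm (θ 2 j) y u := rfl
    rw [h2]
    constructor <;> intro h <;> linarith
  -- On `U`, the form `θ 0 i + θ 1 i = -θ 2 i` vanishes on the third foliation; it is treated as a
  -- combination with constant coefficients.
  let f : Fin 2 → M → ℝ := fun _ _ ↦ 1
  let β : Fin 2 → OneForm M := fun ξ ↦ θ ξ.castSucc i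
  have hβ : ∀ ξ, SmoothFormOn (β ξ) U := fun ξ ↦ hθ.smooth _ _
  have hf : ∀ ξ, SmoothFunOn (f ξ) U := fun ξ ↦ smoothFunOn_one U
  have h := modelD_eq_zero_of_isFoliation (W.isFoliation 2) hU (SmoothFormOn.formSum hf hβ)
    (fun y hy u hu ↦ by
      rw [modelForm_formSum, Fin.sum_univ_two]
      simpa [f, β] using (hmem y hy u).1 hu i) hx ((hmem x hx v).2 hv) ((hmem x hx w).2 hw)
  rw [modelD_formSum hU (fun ξ ↦ (smoothFunOn_iff hU).1 (hf ξ)) hβ hx, Fin.sum_univ_two] at h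
  simpa [f, β, modelDeriv_const] using h

/-- Existence of the Chern connection, the torsion covector and its Pfaffian derivatives. -/
theorem ThreeWeb.IsAdaptedCoframe.exists_structureEquations {W : ThreeWeb M} {U : Set M}
    (hU : IsOpen U) {θ : Fin 3 → Fin 2 → OneForm M} (hθ : W.IsAdaptedCoframe U θ) :
    ∃ (Γ : Fin 2 → Fin 2 → OneForm M) (a : Fin 2 → M → ℝ)
      (p q : Fin 2 → Fin 2 → M → ℝ), StructureEquations U θ Γ a p q := by
  obtain ⟨e, he⟩ := hθ.exists_isDualFrame hU
  have hs : ∀ ξ i η j ζ k, SmoothFunOn (fun x ↦ modelD (θ ζ k) x (e ξ i x) (e η j x)) U :=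
    fun ξ i η j ζ k ↦ he.smooth _ (hθ.smooth ζ k) ξ i η j
  have htors : ∀ i, SmoothFunOn (torsionAux θ e i) U := fun i ↦
    (hs 0 0 0 1 0 i).sub ((hs 0 1 1 0 1 i).neg.sub (hs 0 0 1 1 1 i).neg)
  -- Evaluating the structure equations on mixed pairs forces `Γ j i (e 1 k) = dθ 0 i (e 0 j, e 1
  -- k)` and `Γ j i (e 0 k) = -dθ 1 i (e 0 k, e 1 j)`.
  set Γ := connectionForm θ e with hΓ
  set a := torsionCovector θ e with ha
  -- `torsionAux` is the part of `dθ 0 i (e 0 0, e 0 1)` not accounted for by `Γ`. On this pair the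
  -- torsion term is `-a 1` for `i = 0` and `a 0` for `i = 1`.
  have ha0 : ∀ x, a 0 x = torsionAux θ e 1 x := fun x ↦ by simp [ha, torsionCovector]
  have ha1 : ∀ x, a 1 x = -torsionAux θ e 0 x := fun x ↦ by simp [ha, torsionCovector]
  have hd0 : ∀ x ∈ U, ∀ i, modelD (θ 0 i) x (e 1 0 x) (e 1 1 x) = 0 := fun x hx i ↦
    modelD_eq_zero_of_isFoliation (W.isFoliation 0) hU (hθ.smooth 0 i)
      (fun y hy v hv ↦ (hθ.leaf_iff 0 y hy v).1 hv i) hx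
      ((hθ.leaf_iff 0 x hx (e 1 0 x)).2 fun j ↦ he.apply_zero_one x hx j 0)
      ((hθ.leaf_iff 0 x hx (e 1 1 x)).2 fun j ↦ he.apply_zero_one x hx j 1)
  have hd1 : ∀ x ∈ U, ∀ i, modelD (θ 1 i) x (e 0 0 x) (e 0 1 x) = 0 := fun x hx i ↦
    modelD_eq_zero_of_isFoliation (W.isFoliation 1) hU (hθ.smooth 1 i)
      (fun y hy v hv ↦ (hθ.leaf_iff 1 y hy v).1 hv i) hx
      ((hθ.leaf_iff 1 x hx (e 0 0 x)).2 fun j ↦ he.apply_one_zero x hx j 0)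
      ((hθ.leaf_iff 1 x hx (e 0 1 x)).2 fun j ↦ he.apply_one_zero x hx j 1)
  -- The vectors `e 0 j - e 1 j` are tangent to the third foliation. Its integrability fixes the one
  -- component of `dθ 1 i` still free, which is why the second equation holds with the same covector
  -- and the opposite sign.
  have hd2 : ∀ x ∈ U, ∀ i, modelD (θ 1 i) x (e 1 0 x) (e 1 1 x) =
      -modelD (θ 0 i) x (e 0 0 x) (e 0 1 x) + modelD (θ 0 i) x (e 0 0 x) (e 1 1 x)
        - modelD (θ 0 i) x (e 0 1 x) (e 1 0 x) + modelD (θ 1 i) x (e 0 0 x) (e 1 1 x)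
        - modelD (θ 1 i) x (e 0 1 x) (e 1 0 x) := by
    intro x hx i
    have h := hθ.modelD_third hU i hx (v := e 0 0 x - e 1 0 x) (w := e 0 1 x - e 1 1 x)
      (fun j ↦ by
        simp [he.apply_zero_zero x hx, he.apply_zero_one x hx, he.apply_one_zero x hx,
          he.apply_one_one x hx])
      (fun j ↦ by
        simp [he.apply_zero_zero x hx, he.apply_zero_one x hx, he.apply_one_zero x hx,
          he.apply_one_one x hx])
    rw [he.modelD_expand (hθ.smooth 0 i) hx, he.modelD_expand (hθ.smooth 1 i) hx] at h
    simp only [map_sub, he.apply_zero_zero x hx, he.apply_zero_one x hx, he.apply_one_zero x hx,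
      he.apply_one_one x hx, hd0 x hx, hd1 x hx] at h
    simp at h
    linarith
  -- The covariant differential of `a i`; its components in the dual frame are `p` and `q`.
  let L : Fin 2 → M → E4 →L[ℝ] ℝ := fun i x ↦
    modelDeriv (a i) x - ∑ j, a j x • modelForm (Γ i j) x
  refine ⟨Γ, a, fun i j x ↦ L i x (e 0 j x), fun i j x ↦ L i x (e 1 j x), ?_, ?_, ?_, ?_, ?_⟩
  · intro j i
    refine SmoothFormOn.formSum (fun c ↦ ?_) fun c ↦ hθ.smooth _ _
    by_cases hc : c.1 = 0
    · simpa only [hc, if_true] using (hs 0 c.2 1 j 1 i).neg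
    · simpa only [hc, if_false] using hs 0 j 1 c.2 0 i
  · intro i
    rw [← smoothFunOn_iff hU]
    fin_cases i
    · exact (funext ha0 : a 0 = _) ▸ htors 1
    · exact (funext ha1 : a 1 = _) ▸ (htors 0).neg
  · have key : ∀ i, ∀ x ∈ U, ∀ v w : E4, modelD (θ 0 i) x v w =
        ∑ j, (modelForm (θ 0 j) x v * modelForm (Γ j i) x w -
          modelForm (θ 0 j) x w * modelForm (Γ j i) x v) +
        ∑ j, a j x * (modelForm (θ 0 j) x v * modelForm (θ 0 i) x w -
          modelForm (θ 0 j) x w * modelForm (θ 0 i) x v) := by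
      intro i x hx v w
      rw [he.modelD_expand (hθ.smooth 0 i) hx]
      simp only [hΓ, modelForm_connectionForm, Fin.sum_univ_two, hd0 x hx, ha0, ha1, torsionAux]
      fin_cases i <;> simp only [Fin.zero_eta, Fin.mk_one] <;> ring
    exact key
  · have key : ∀ i, ∀ x ∈ U, ∀ v w : E4, modelD (θ 1 i) x v w =
        ∑ j, (modelForm (θ 1 j) x v * modelForm (Γ j i) x w -
          modelForm (θ 1 j) x w * modelForm (Γ j i) x v) -
        ∑ j, a j x * (modelForm (θ 1 j) x v * modelForm (θ 1 i) x w -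
          modelForm (θ 1 j) x w * modelForm (θ 1 i) x v) := by
      intro i x hx v w
      rw [he.modelD_expand (hθ.smooth 1 i) hx]
      simp only [hΓ, modelForm_connectionForm, Fin.sum_univ_two, hd1 x hx, hd2 x hx, ha0, ha1,
        torsionAux]
      fin_cases i <;> simp only [Fin.zero_eta, Fin.mk_one] <;> ring
    exact key
  · have key : ∀ i, ∀ x ∈ U, ∀ v : E4,
        modelDeriv (a i) x v - ∑ j, a j x * modelForm (Γ i j) x v =
        ∑ j, (L i x (e 0 j x) * modelForm (θ 0 j) x v +
          L i x (e 1 j x) * modelForm (θ 1 j) x v) := by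
      intro i x hx v
      have h1 : modelDeriv (a i) x v - ∑ j, a j x * modelForm (Γ i j) x v = L i x v := by
        simp [L]
      rw [h1, Fin.sum_univ_two]
      conv_lhs => rw [he.expand x hx v]
      simp only [map_add, map_smul, smul_eq_mul]
      ring
    exact key

end Existence

/-! ### Integrability of the transversal distribution -/

section Integrability

variable {M : Type*} [TopologicalSpace M] [ChartedSpace (EuclideanSpace ℝ (Fin 4)) M]
  [IsManifold (𝓡 4) ∞ M]

local notation "E4" => EuclideanSpace ℝ (Fin 4)
local notation "E2" => EuclideanSpace ℝ (Fin 2)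

/-- The Pfaffian form of the covariant differential of `a i`. -/
noncomputable def pfaffianForm (θ : Fin 3 → Fin 2 → OneForm M) (p q : Fin 2 → Fin 2 → M → ℝ)
    (i : Fin 2) (x : M) (v : E4) : ℝ :=
  ∑ j, (p i j x * modelForm (θ 0 j) x v + q i j x * modelForm (θ 1 j) x v)

variable {U : Set M} {θ : Fin 3 → Fin 2 → OneForm M}
  {Γ : Fin 2 → Fin 2 → OneForm M} {a : Fin 2 → M → ℝ} {p q : Fin 2 → Fin 2 → M → ℝ}

/-- The connection terms of `dθ 0 i` complete `da i` to its covariant differential, and `a i a j θ 0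
j ∧ θ 0 i` vanishes by skew symmetry. The sign of the torsion term is therefore irrelevant, and
`modelD_one` has the same form. -/
theorem StructureEquations.modelD_zero (h : StructureEquations U θ Γ a p q) (hU : IsOpen U)
    (hθ : ∀ i, SmoothFormOn (θ 0 i) U) {x : M} (hx : x ∈ U) (v w : E4) :
    modelD (formSum a (θ 0)) x v w =
      ∑ i, (pfaffianForm θ p q i x v * modelForm (θ 0 i) x w -
        pfaffianForm θ p q i x w * modelForm (θ 0 i) x v) := by
  have hd : ∀ i, modelD (θ 0 i) x v w =
        ∑ j, (modelForm (θ 0 j) x v * modelForm (Γ j i) x w -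
          modelForm (θ 0 j) x w * modelForm (Γ j i) x v) +
        ∑ j, a j x * (modelForm (θ 0 j) x v * modelForm (θ 0 i) x w -
          modelForm (θ 0 j) x w * modelForm (θ 0 i) x v) := fun i ↦ h.first i x hx v w
  have hp : ∀ i u, modelDeriv (a i) x u = pfaffianForm θ p q i x u +
      ∑ j, a j x * modelForm (Γ i j) x u := fun i u ↦
    eq_add_of_sub_eq (h.pfaffian i x hx u)
  rw [modelD_formSum hU h.smooth_covector hθ hx]
  simp only [hd, hp, Fin.sum_univ_two]
  ring

theorem StructureEquations.modelD_one (h : StructureEquations U θ Γ a p q) (hU : IsOpen U)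
    (hθ : ∀ i, SmoothFormOn (θ 1 i) U) {x : M} (hx : x ∈ U) (v w : E4) :
    modelD (formSum a (θ 1)) x v w =
      ∑ i, (pfaffianForm θ p q i x v * modelForm (θ 1 i) x w -
        pfaffianForm θ p q i x w * modelForm (θ 1 i) x v) := by
  have hd : ∀ i, modelD (θ 1 i) x v w =
        ∑ j, (modelForm (θ 1 j) x v * modelForm (Γ j i) x w -
          modelForm (θ 1 j) x w * modelForm (Γ j i) x v) -
        ∑ j, a j x * (modelForm (θ 1 j) x v * modelForm (θ 1 i) x w -
          modelForm (θ 1 j) x w * modelForm (θ 1 i) x v) := fun i ↦ h.second i x hx v w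
  have hp : ∀ i u, modelDeriv (a i) x u = pfaffianForm θ p q i x u +
      ∑ j, a j x * modelForm (Γ i j) x u := fun i u ↦
    eq_add_of_sub_eq (h.pfaffian i x hx u)
  rw [modelD_formSum hU h.smooth_covector hθ hx]
  simp only [hd, hp, Fin.sum_univ_two]
  ring

/-- The line orthogonal to `(a, b)` is spanned by `(-b, a)`; the coefficient is found by orthogonal
projection. -/
theorem exists_eq_mul_of_mul_add_mul_eq_zero {a b y z : ℝ} (hab : (a, b) ≠ (0, 0))
    (h : a * y + b * z = 0) : ∃ s, y = -b * s ∧ z = a * s := by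
  have h0 : a ^ 2 + b ^ 2 ≠ 0 := fun h0 ↦ hab (by
    have ha : a = 0 := by nlinarith [sq_nonneg a, sq_nonneg b]
    have hb : b = 0 := by nlinarith [sq_nonneg a, sq_nonneg b]
    rw [ha, hb])
  refine ⟨(a * z - b * y) / (a ^ 2 + b ^ 2), ?_, ?_⟩ <;> field_simp
  · linear_combination a * h
  · linear_combination b * h

theorem StructureEquations.isIntegrableOn_iff {W : ThreeWeb M} (hU : IsOpen U)
    (hθ : W.IsAdaptedCoframe U θ) (h : StructureEquations U θ Γ a p q)
    (ha : ∀ x ∈ U, (a 0 x, a 1 x) ≠ (0, 0)) :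
    IsIntegrableOn (transversalDistribution θ a) U ↔ ∀ x ∈ U,
      a 1 x ^ 2 * p 0 0 x - 2 * a 0 x * a 1 x * ((p 0 1 x + p 1 0 x) / 2)
        + a 0 x ^ 2 * p 1 1 x = 0 ∧
      a 1 x ^ 2 * q 0 0 x - 2 * a 0 x * a 1 x * ((q 0 1 x + q 1 0 x) / 2)
        + a 0 x ^ 2 * q 1 1 x = 0 := by
  obtain ⟨e, he⟩ := hθ.exists_isDualFrame hU
  have hsm : ∀ ξ, SmoothFormOn (formSum a (θ ξ)) U := fun ξ ↦
    SmoothFormOn.formSum (fun i ↦ (smoothFunOn_iff hU).2 (h.smooth_covector i)) (hθ.smooth ξ)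
  have hmem : ∀ x, ∀ v : E4, v ∈ transversalDistribution θ a x ↔
      modelForm (formSum a (θ 0)) x v = 0 ∧ modelForm (formSum a (θ 1)) x v = 0 :=
    fun x v ↦ Iff.rfl
  have hval : ∀ ξ x v, modelForm (formSum a (θ ξ)) x v =
      a 0 x * modelForm (θ ξ 0) x v + a 1 x * modelForm (θ ξ 1) x v := fun ξ x v ↦ by
    rw [modelForm_formSum, Fin.sum_univ_two]; rfl
  constructor
  · intro hint x hx
    obtain ⟨V, φ, hV, h0V, rfl, hmaps, hφ, himm⟩ := hint x hx
    have hrange : ∀ t ∈ V, ∀ v : E4, v ∈ transversalDistribution θ a (φ t) ↔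
        ∃ τ, surfaceDeriv φ t τ = v := fun t ht v ↦ by
      rw [← (himm t ht).2]; rfl
    have hz : ∀ v ∈ transversalDistribution θ a (φ 0), ∀ w ∈ transversalDistribution θ a (φ 0),
        modelD (formSum a (θ 0)) (φ 0) v w = 0 ∧ modelD (formSum a (θ 1)) (φ 0) v w = 0 := by
      intro v hv w hw
      obtain ⟨τ, rfl⟩ := (hrange 0 h0V v).1 hv
      obtain ⟨σ, rfl⟩ := (hrange 0 h0V w).1 hw
      exact ⟨modelD_eq_zero_of_surface (hsm 0) hV hφ hmaps (fun t ht τ ↦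
          ((hmem _ _).1 ((hrange t ht _).2 ⟨τ, rfl⟩)).1) h0V τ σ,
        modelD_eq_zero_of_surface (hsm 1) hV hφ hmaps (fun t ht τ ↦
          ((hmem _ _).1 ((hrange t ht _).2 ⟨τ, rfl⟩)).2) h0V τ σ⟩
    set x := φ 0
    -- This vector and the next form the basis of the plane on which the derivatives become the
    -- quadratic forms of `q` (up to sign) and `p`.
    have hv := (hmem x (-a 1 x • e 0 0 x + a 0 x • e 0 1 x)).2 (by
      simp [hval, he.apply_zero_zero x hx, he.apply_one_zero x hx]; ring)
    have hw := (hmem x (-a 1 x • e 1 0 x + a 0 x • e 1 1 x)).2 (by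
      simp [hval, he.apply_zero_one x hx, he.apply_one_one x hx]; ring)
    obtain ⟨h0, h1⟩ := hz _ hv _ hw
    rw [h.modelD_zero hU (hθ.smooth 0) hx] at h0
    rw [h.modelD_one hU (hθ.smooth 1) hx] at h1
    simp [pfaffianForm, Fin.sum_univ_two, he.apply_zero_zero x hx, he.apply_one_zero x hx,
      he.apply_zero_one x hx, he.apply_one_one x hx] at h0 h1
    constructor
    · linear_combination h1
    · linear_combination -h0
  · intro hpq
    refine isIntegrableOn_of_modelD_eq_zero (α := fun ξ ↦ formSum a (θ ξ.castSucc)) hU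
      (fun ξ ↦ hsm _) (fun x hx y ↦ ?_) (fun x hx v w hv hw ↦ ?_)
    · have hne : a 0 x ^ 2 + a 1 x ^ 2 ≠ 0 := fun h0 ↦ ha x hx (by
        have h1 : a 0 x = 0 := by nlinarith [sq_nonneg (a 0 x), sq_nonneg (a 1 x)]
        have h2 : a 1 x = 0 := by nlinarith [sq_nonneg (a 0 x), sq_nonneg (a 1 x)]
        rw [h1, h2])
      -- In each half of the frame, the vector with components `(a 0, a 1)` is sent to `a 0 ^ 2 + a
      -- 1 ^ 2` by the form of that half and to `0` by the other.
      refine ⟨(y 0 / (a 0 x ^ 2 + a 1 x ^ 2)) • (a 0 x • e 0 0 x + a 1 x • e 0 1 x) +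
        (y 1 / (a 0 x ^ 2 + a 1 x ^ 2)) • (a 0 x • e 1 0 x + a 1 x • e 1 1 x), ?_⟩
      ext ξ
      fin_cases ξ <;>
      · simp [hval, he.apply_zero_zero x hx, he.apply_one_zero x hx,
          he.apply_zero_one x hx, he.apply_one_one x hx]
        field_simp
    · have hv0 : a 0 x * modelForm (θ 0 0) x v + a 1 x * modelForm (θ 0 1) x v = 0 :=
        (hval 0 x v).symm.trans (hv 0)
      have hv1 : a 0 x * modelForm (θ 1 0) x v + a 1 x * modelForm (θ 1 1) x v = 0 :=
        (hval 1 x v).symm.trans (hv 1)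
      have hw0 : a 0 x * modelForm (θ 0 0) x w + a 1 x * modelForm (θ 0 1) x w = 0 :=
        (hval 0 x w).symm.trans (hw 0)
      have hw1 : a 0 x * modelForm (θ 1 0) x w + a 1 x * modelForm (θ 1 1) x w = 0 :=
        (hval 1 x w).symm.trans (hw 1)
      obtain ⟨s, hs, hs'⟩ := exists_eq_mul_of_mul_add_mul_eq_zero (ha x hx) hv0
      obtain ⟨t, ht, ht'⟩ := exists_eq_mul_of_mul_add_mul_eq_zero (ha x hx) hv1
      obtain ⟨s₂, hs₂, hs₂'⟩ := exists_eq_mul_of_mul_add_mul_eq_zero (ha x hx) hw0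
      obtain ⟨t₂, ht₂, ht₂'⟩ := exists_eq_mul_of_mul_add_mul_eq_zero (ha x hx) hw1
      obtain ⟨hp, hq⟩ := hpq x hx
      rw [Fin.forall_fin_two]
      constructor
      · refine (h.modelD_zero hU (hθ.smooth 0) hx v w).trans ?_
        simp only [pfaffianForm, Fin.sum_univ_two, hs, hs', ht, ht', hs₂, hs₂', ht₂, ht₂']
        -- Here `(s, t)` and `(s₂, t₂)` are the coordinates of `v` and `w` in the basis of the
        -- plane. The `p` terms cancel, and the determinant of the coordinates multiplies the
        -- quadratic form of `q`.
        linear_combination (t * s₂ - t₂ * s) * hq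
      · refine (h.modelD_one hU (hθ.smooth 1) hx v w).trans ?_
        simp only [pfaffianForm, Fin.sum_univ_two, hs, hs', ht, ht', hs₂, hs₂', ht₂, ht₂']
        linear_combination (s * t₂ - s₂ * t) * hp

end Integrability

end

end ThreeWebs

theorem theorem1 {M : Type*} [TopologicalSpace M] [ChartedSpace (EuclideanSpace ℝ (Fin 4)) M]
    [IsManifold (𝓡 4) ∞ M] (W : ThreeWebs.ThreeWeb M) (U : Set M) (hU : IsOpen U)
    (θ : Fin 3 → Fin 2 → ThreeWebs.OneForm M) (hθ : W.IsAdaptedCoframe U θ) :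
    (∃ (Γ : Fin 2 → Fin 2 → ThreeWebs.OneForm M) (a : Fin 2 → M → ℝ)
      (p q : Fin 2 → Fin 2 → M → ℝ), ThreeWebs.StructureEquations U θ Γ a p q) ∧
    ∀ (Γ : Fin 2 → Fin 2 → ThreeWebs.OneForm M) (a : Fin 2 → M → ℝ)
      (p q : Fin 2 → Fin 2 → M → ℝ), ThreeWebs.StructureEquations U θ Γ a p q →
      (∀ x ∈ U, (a 0 x, a 1 x) ≠ (0, 0)) →
      (ThreeWebs.IsIntegrableOn (ThreeWebs.transversalDistribution θ a) U ↔
        ∀ x ∈ U,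
          a 1 x ^ 2 * p 0 0 x - 2 * a 0 x * a 1 x * ((p 0 1 x + p 1 0 x) / 2)
            + a 0 x ^ 2 * p 1 1 x = 0 ∧
          a 1 x ^ 2 * q 0 0 x - 2 * a 0 x * a 1 x * ((q 0 1 x + q 1 0 x) / 2)
            + a 0 x ^ 2 * q 1 1 x = 0) :=
  ⟨hθ.exists_structureEquations hU, fun _ _ _ _ h ha ↦ h.isIntegrableOn_iff hU hθ ha⟩
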